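/- Let $0<a<\infty$, $I=(-a,a)$, and let $q\in C^\infty(I)$ be complex-valued. Let $H$ be the unique continuous solution of $$H(u,v)=\frac12\int_0^u q(s)\,ds+\int_0^u\int_0^v q(\alpha+\beta)H(\alpha,\beta)\,d\beta\,d\alpha$$ on the open square $\{|u|+|v|<a\}$ (such an $H$ exists and is unique), and put $K(x,t)=H\left(\frac{x+t}2,\frac{x-t}2\right)$ for $x,t\in I$. Let $\mathcal D'(I)$ be the space of complex distributions on $I$, i.e. of continuous linear functionals on $C_c^\infty(I)$ (with its inductive limit topology), with the topology of pointwise convergence. For $\psi\in C_c^\infty(I)$ and $x\in I$ put $$\mathbf T^\square\psi(x)=\psi(x)-\int_{-a}^{-|x|}K(t,x)\psi(t)\,dt+\int_{|x|}^{a}K(t,x)\psi(t)\,dt .$$ Then $\mathbf T^\square$ is a continuous linear operator from $C_c^\infty(I)$ to itself, and the operator $\mathbf T$ defined by $$\langle\mathbf Tu,\phi\rangle=\langle u,\mathbf T^\square\phi\rangle,\qquad u\in\mathcal D'(I),\ \phi\in C_c^\infty(I),$$ is a continuous linear operator $\mathcal D'(I)\to\mathcal D'(I)$ which is invertible with continuous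 inverse. It extends the Volterra operator $\mathbf Tf(x)=f(x)+\int_{-x}^{x}K(x,t)f(t)\,dt$: for every $f\in L^1_{loc}(I)$ the function $\mathbf Tf$ is in $L^1_{loc}(I)$, and $\mathbf T$ maps the regular distribution of $f$ to that of $\mathbf Tf$. Moreover $\mathbf T$ is a transmutation operator on $\mathcal D'(I)$: for every $u\in\mathcal D'(I)$, $$\left(\frac{d^2}{dx^2}-q\right)\mathbf Tu=\mathbf T\frac{d^2}{dx^2}u\quad\text{in }\mathcal D'(I).$$ -/

import Mathlib

open Set Filter Topology MeasureTheory
open scoped ContDiff Distributions Manifold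

namespace Transmutation

/-! ### Test functions and distributions on `I = (-a, a)` -/

/-- The open interval `I = (-a, a)`. -/
def symInterval (a : ℝ) : TopologicalSpace.Opens ℝ := ⟨Ioo (-a) a, isOpen_Ioo⟩

/-- Test functions on `I`: complex-valued smooth functions with compact support in `I`, with the
usual inductive limit topology. -/
abbrev TestFun (a : ℝ) : Type := 𝓓(symInterval a, ℂ)

/-- Distributions on `I`: continuous `ℂ`-linear functionals on the space of test functions, with the
topology of pointwise convergence. -/
abbrev Distr (a : ℝ) : Type := TestFun a →Lₚₜ[ℂ] ℂ

/-- The (regular) distribution `φ ↦ ∫ f φ` of a function `f` that is locally integrable on `I`. -/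
noncomputable def regularDistr (a : ℝ) (f : ℝ → ℂ) : Distr a :=
  (TestFunction.integralAgainstBilinCLM (ContinuousLinearMap.mul ℂ ℂ) volume f :
    TestFun a →L[ℂ] ℂ)

/-- The derivative of a distribution: `⟨u', φ⟩ = -⟨u, φ'⟩`. -/
noncomputable def distrDeriv (a : ℝ) : Distr a →L[ℂ] Distr a :=
  -PointwiseConvergenceCLM.precomp ℂ
    (TestFunction.lineDerivCLM ℂ (1 : ℝ) : TestFun a →L[ℂ] TestFun a)

theorem contDiff_mul_of_eventually_zero {a : ℝ} {q h : ℝ → ℂ}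
    (hq : ContDiffOn ℝ ∞ q (Ioo (-a) a)) (hh : ContDiff ℝ ∞ h)
    (h0 : ∀ x ∉ Ioo (-a) a, ∀ᶠ y in 𝓝 x, h y = 0) :
    ContDiff ℝ ∞ (fun x ↦ q x * h x) := by
  rw [contDiff_iff_contDiffAt]
  intro x
  by_cases hx : x ∈ Ioo (-a) a
  · exact (hq.contDiffAt (isOpen_Ioo.mem_nhds hx)).mul hh.contDiffAt
  · refine (contDiffAt_const (c := (0 : ℂ))).congr_of_eventuallyEq ?_
    filter_upwards [h0 x hx] with y hy
    simp [hy]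

theorem contDiff_mul_testFun {a : ℝ} {q : ℝ → ℂ} (hq : ContDiffOn ℝ ∞ q (Ioo (-a) a))
    (φ : TestFun a) : ContDiff ℝ ∞ (fun x ↦ q x * φ x) := by
  refine contDiff_mul_of_eventually_zero hq φ.contDiff fun x hx ↦ ?_
  exact notMem_tsupport_iff_eventuallyEq.mp fun h ↦ hx (φ.tsupport_subset h)

theorem exists_smooth_eq_on_compact {a : ℝ} {q : ℝ → ℂ} (hq : ContDiffOn ℝ ∞ q (Ioo (-a) a))
    (K : TopologicalSpace.Compacts ℝ) (hK : (K : Set ℝ) ⊆ symInterval a) :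
    ∃ g : ℝ → ℂ, ContDiff ℝ ∞ g ∧ ∀ x ∈ K, g x = q x := by
  obtain ⟨χ, h0, h1, -⟩ := exists_contMDiffMap_zero_one_nhds_of_isClosed (n := ⊤) 𝓘(ℝ, ℝ)
    (s := (Ioo (-a) a)ᶜ) (t := (K : Set ℝ)) isOpen_Ioo.isClosed_compl K.isCompact.isClosed
    (disjoint_compl_left_iff_subset.mpr hK)
  refine ⟨fun x ↦ q x * (χ x : ℂ), contDiff_mul_of_eventually_zero hq ?_ ?_, fun x hx ↦ ?_⟩
  · exact Complex.ofRealCLM.contDiff.comp χ.contMDiff.contDiff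
  · intro x hx
    filter_upwards [eventually_nhdsSet_iff_forall.mp h0 x hx] with y hy
    simp [hy]
  · simp [(eventually_nhdsSet_iff_forall.mp h1 x hx).self_of_nhds]

/-- Multiplication of test functions on `I` by a function `q ∈ C^∞(I)`. -/
noncomputable def mulTestFun {a : ℝ} {q : ℝ → ℂ} (hq : ContDiffOn ℝ ∞ q (Ioo (-a) a)) :
    TestFun a →L[ℂ] TestFun a :=
  TestFunction.limitCLM ℂ
    (fun φ ↦ ⟨fun x ↦ q x * φ x, contDiff_mul_testFun hq φ, φ.hasCompactSupport.mul_left,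
      (tsupport_mul_subset_right (f := q) (g := φ)).trans φ.tsupport_subset⟩)
    (fun K hK ↦ (TestFunction.ofSupportedInCLM ℂ hK).comp
      (ContDiffMapSupportedIn.bilinLeftCLM (ContinuousLinearMap.mul ℂ ℂ)
        (exists_smooth_eq_on_compact hq K hK).choose_spec.1))
    (fun K hK φ ↦ by
      ext x
      change q x * φ x = φ x * (exists_smooth_eq_on_compact hq K hK).choose x
      by_cases hx : x ∈ K
      · rw [(exists_smooth_eq_on_compact hq K hK).choose_spec.2 x hx, mul_comm]
      · simp [φ.zero_on_compl hx])

theorem mulTestFun_apply {a : ℝ} {q : ℝ → ℂ} (hq : ContDiffOn ℝ ∞ q (Ioo (-a) a))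
    (φ : TestFun a) (x : ℝ) : mulTestFun hq φ x = q x * φ x := rfl

/-- The product `q u` of `q ∈ C^∞(I)` and a distribution: `⟨q u, φ⟩ = ⟨u, q φ⟩`. -/
noncomputable def mulDistr {a : ℝ} {q : ℝ → ℂ} (hq : ContDiffOn ℝ ∞ q (Ioo (-a) a)) :
    Distr a →L[ℂ] Distr a :=
  PointwiseConvergenceCLM.precomp ℂ (mulTestFun hq)

/-- `T` is a transmutation operator on the set `χ` of distributions on `I`:
`(d²/dx² - q) T u = T (d²/dx²) u` in `𝓓'(I)` for all `u ∈ χ`. -/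
def IsTransmutationOn {a : ℝ} {q : ℝ → ℂ} (hq : ContDiffOn ℝ ∞ q (Ioo (-a) a))
    (T : Distr a →ₗ[ℂ] Distr a) (χ : Set (Distr a)) : Prop :=
  ∀ u ∈ χ, distrDeriv a (distrDeriv a (T u)) - mulDistr hq (T u) =
    T (distrDeriv a (distrDeriv a u))

/-! ### The kernel and the Volterra operator -/

/-- The image of the square `I × I` under `u = (x + t) / 2`, `v = (x - t) / 2`, that is, the open
square with vertices `(±a, 0)`, `(0, ±a)`. -/
def charSquare (a : ℝ) : Set (ℝ × ℝ) := {p | |p.1| + |p.2| < a}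

/-- `H` is a continuous solution on the square of the integral equation
`H(u, v) = ½ ∫₀ᵘ q(s) ds + ∫₀ᵘ ∫₀ᵛ q(α + β) H(α, β) dβ dα`. -/
structure IsKernelSolution (a : ℝ) (q : ℝ → ℂ) (H : ℝ × ℝ → ℂ) : Prop where
  continuousOn : ContinuousOn H (charSquare a)
  integral_eq : ∀ u v : ℝ, (u, v) ∈ charSquare a →
    H (u, v) = (1 / 2) * (∫ s in (0 : ℝ)..u, q s) +
      ∫ α in (0 : ℝ)..u, ∫ β in (0 : ℝ)..v, q (α + β) * H (α, β)

/-- `K(x, t) = H((x + t) / 2, (x - t) / 2)`. -/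
noncomputable def kernel (H : ℝ × ℝ → ℂ) (x t : ℝ) : ℂ := H ((x + t) / 2, (x - t) / 2)

/-- The Volterra operator `f ↦ f(x) + ∫_{-x}^{x} K(x, t) f(t) dt` on functions. -/
noncomputable def volterra (K : ℝ → ℝ → ℂ) (f : ℝ → ℂ) (x : ℝ) : ℂ :=
  f x + ∫ t in (-x)..x, K x t * f t

/-- The transposed operator
`ψ ↦ ψ(x) - ∫_{-a}^{-|x|} K(t, x) ψ(t) dt + ∫_{|x|}^{a} K(t, x) ψ(t) dt`. -/
noncomputable def volterraTranspose (a : ℝ) (K : ℝ → ℝ → ℂ) (ψ : ℝ → ℂ) (x : ℝ) : ℂ :=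
  ψ x - (∫ t in (-a)..(-|x|), K t x * ψ t) + ∫ t in |x|..a, K t x * ψ t

end Transmutation

/-! Everything is proved on the test function side and transposed at the end.

A test function vanishes outside some `[-r, r]` with `r < a`, and its image under the transposed
operator vanishes there too. Only the values of the kernel on `[-r, r] × [-r, r]` matter, and they
depend only on `q` on `[-r, r]`. So `q` may be replaced by a smooth function `p` on the whole line
that agrees with `q` on `[-r, r]`, and the kernel by one that is smooth on the plane.

The integral equation is a Goursat problem `∂u ∂v H = Q H`. Its Picard series converges with
factorial bounds (`exists_continuous_goursat`), the same bounds give uniqueness (`goursat_unique`),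
and the equation itself bootstraps continuity to smoothness (`contDiff_goursat`). In the variables
`x, t` the kernel satisfies `K_xx - K_tt = (q₁(x) - q₂(t)) K` with prescribed values on `t = ±x`.
The Leibniz rule and two integrations by parts then show that the Volterra operator intertwines
`d²/dx² - q₂` with `d²/dx² - q₁` (`deriv_deriv_volterra`).

A second Goursat problem, with coefficient `-q(α - β)`, gives a kernel `L` that intertwines in the
opposite direction. The operator of `L` after that of `K` commutes with `d²/dx²` and preserves the
value and the derivative at `0`, so it fixes every monomial (`volterra_volterra_pow`).

Fubini identifies `volterraTranspose` as the transpose (`integral_mul_volterra`), and a compactly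
supported continuous function with vanishing moments is zero. Identities checked on monomials thus
become identities for the transposed operators: one composition is the identity
(`volterraTranspose_comp`), and the transposed intertwining relation holds
(`deriv_deriv_volterraTranspose`). The other composition follows because the transposed operator of
`K` is injective (`eq_zero_of_volterraTranspose_eq_zero`), again by a factorial estimate. Continuity
on test functions comes from seminorm bounds by induction on the order of the derivative
(`hasDerivBound_transposeIntegral`). -/

namespace Transmutation

/-! ### Calculus for functions of two real variables -/

/-- The partial derivative in the first variable. -/
noncomputable def partialFst (f : ℝ → ℝ → ℂ) (x y : ℝ) : ℂ := deriv (fun s ↦ f s y) x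

/-- The partial derivative in the second variable. -/
noncomputable def partialSnd (f : ℝ → ℝ → ℂ) (x y : ℝ) : ℂ := deriv (fun s ↦ f x s) y

theorem hasFDerivAt_uncurry_of_partials {f f₁ f₂ : ℝ → ℝ → ℂ}
    (h₁ : ∀ x y, HasDerivAt (fun s ↦ f s y) (f₁ x y) x)
    (h₂ : ∀ x y, HasDerivAt (fun s ↦ f x s) (f₂ x y) y)
    (c₁ : Continuous ↿f₁) (c₂ : Continuous ↿f₂) (p : ℝ × ℝ) :
    HasFDerivAt ↿f (((1 : ℝ →L[ℝ] ℝ).smulRight (f₁ p.1 p.2)).coprod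
      ((1 : ℝ →L[ℝ] ℝ).smulRight (f₂ p.1 p.2))) p := by
  have key := hasStrictFDerivAt_uncurry_coprod (𝕜 := ℝ) (u := p) (f := f)
    (f₁ := fun x y ↦ (1 : ℝ →L[ℝ] ℝ).smulRight (f₁ x y))
    (f₂ := fun x y ↦ (1 : ℝ →L[ℝ] ℝ).smulRight (f₂ x y))
    (Eventually.of_forall fun v ↦ (h₁ v.1 v.2).hasFDerivAt)
    (Eventually.of_forall fun v ↦ (h₂ v.1 v.2).hasFDerivAt) ?_ ?_
  · exact key.hasFDerivAt
  · exact ((ContinuousLinearMap.smulRightL ℝ ℝ ℂ 1).continuous.comp c₁).continuousAt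
  · exact ((ContinuousLinearMap.smulRightL ℝ ℝ ℂ 1).continuous.comp c₂).continuousAt

/-- The derivative applied to a fixed vector is a fixed linear combination of the partials. This is
the inductive step of the smoothness proofs for parametric primitives and for Goursat solutions. -/
theorem contDiff_succ_uncurry_of_partials {n : ℕ} {f f₁ f₂ : ℝ → ℝ → ℂ}
    (h₁ : ∀ x y, HasDerivAt (fun s ↦ f s y) (f₁ x y) x)
    (h₂ : ∀ x y, HasDerivAt (fun s ↦ f x s) (f₂ x y) y)
    (c₁ : ContDiff ℝ n ↿f₁) (c₂ : ContDiff ℝ n ↿f₂) : ContDiff ℝ (n + 1) ↿f := by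
  have key := hasFDerivAt_uncurry_of_partials h₁ h₂ c₁.continuous c₂.continuous
  rw [contDiff_succ_iff_fderiv_apply]
  refine ⟨fun p ↦ (key p).differentiableAt, by simp, fun y ↦ ?_⟩
  have : (fun p ↦ fderiv ℝ ↿f p y) = fun p ↦ y.1 • (↿f₁ p) + y.2 • (↿f₂ p) := by
    ext p
    rw [(key p).fderiv]
    simp [Function.HasUncurry.uncurry]
  rw [this]
  exact (c₁.const_smul _).add (c₂.const_smul _)

theorem hasDerivAt_partialFst {f : ℝ → ℝ → ℂ} (hf : Differentiable ℝ ↿f) (x y : ℝ) :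
    HasDerivAt (fun s ↦ f s y) (partialFst f x y) x := by
  refine DifferentiableAt.hasDerivAt ?_
  exact (hf (x, y)).comp (f := fun s : ℝ ↦ (s, y)) x (by fun_prop)

theorem hasDerivAt_partialSnd {f : ℝ → ℝ → ℂ} (hf : Differentiable ℝ ↿f) (x y : ℝ) :
    HasDerivAt (fun s ↦ f x s) (partialSnd f x y) y := by
  refine DifferentiableAt.hasDerivAt ?_
  exact (hf (x, y)).comp (f := fun s : ℝ ↦ (x, s)) y (by fun_prop)

theorem partialFst_eq_fderiv {f : ℝ → ℝ → ℂ} (hf : Differentiable ℝ ↿f) (p : ℝ × ℝ) :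
    ↿(partialFst f) p = fderiv ℝ ↿f p (1, 0) := by
  refine HasDerivAt.deriv ?_
  exact (hf (p.1, p.2)).hasFDerivAt.comp_hasDerivAt p.1
    ((hasDerivAt_id p.1).prodMk (hasDerivAt_const p.1 p.2))

theorem partialSnd_eq_fderiv {f : ℝ → ℝ → ℂ} (hf : Differentiable ℝ ↿f) (p : ℝ × ℝ) :
    ↿(partialSnd f) p = fderiv ℝ ↿f p (0, 1) := by
  refine HasDerivAt.deriv ?_
  exact (hf (p.1, p.2)).hasFDerivAt.comp_hasDerivAt p.2
    ((hasDerivAt_const p.2 p.1).prodMk (hasDerivAt_id p.2))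

theorem contDiff_partialFst {n m : ℕ∞ω} {f : ℝ → ℝ → ℂ} (hf : ContDiff ℝ n ↿f)
    (hmn : m + 1 ≤ n) : ContDiff ℝ m ↿(partialFst f) := by
  have h1 : n ≠ 0 := by rintro rfl; simp at hmn
  rw [show ↿(partialFst f) = fun p ↦ fderiv ℝ ↿f p (1, 0) from
    funext (partialFst_eq_fderiv (hf.differentiable h1))]
  exact (hf.fderiv_right hmn).clm_apply contDiff_const

theorem contDiff_partialSnd {n m : ℕ∞ω} {f : ℝ → ℝ → ℂ} (hf : ContDiff ℝ n ↿f)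
    (hmn : m + 1 ≤ n) : ContDiff ℝ m ↿(partialSnd f) := by
  have h1 : n ≠ 0 := by rintro rfl; simp at hmn
  rw [show ↿(partialSnd f) = fun p ↦ fderiv ℝ ↿f p (0, 1) from
    funext (partialSnd_eq_fderiv (hf.differentiable h1))]
  exact (hf.fderiv_right hmn).clm_apply contDiff_const

theorem hasDerivAt_uncurry_comp {f : ℝ → ℝ → ℂ} (hf : Differentiable ℝ ↿f) {g h : ℝ → ℝ}
    {g' h' s : ℝ} (hg : HasDerivAt g g' s) (hh : HasDerivAt h h' s) :
    HasDerivAt (fun s ↦ f (g s) (h s))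
      (g' • partialFst f (g s) (h s) + h' • partialSnd f (g s) (h s)) s := by
  have key := (hf (g s, h s)).hasFDerivAt.comp_hasDerivAt s (hg.prodMk hh)
  refine key.congr_deriv ?_
  have e1 := partialFst_eq_fderiv hf (g s, h s)
  have e2 := partialSnd_eq_fderiv hf (g s, h s)
  change partialFst f (g s) (h s) = _ at e1
  change partialSnd f (g s) (h s) = _ at e2
  rw [e1, e2, ← map_smul, ← map_smul, ← map_add]
  simp

/-- The primitive `∫_0^y f(x, s) ds` in the second variable. -/
noncomputable def primitiveSnd (f : ℝ → ℝ → ℂ) (x y : ℝ) : ℂ := ∫ s in (0 : ℝ)..y, f x s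

theorem hasDerivAt_primitiveSnd_snd {f : ℝ → ℝ → ℂ} (hf : Continuous ↿f) (x y : ℝ) :
    HasDerivAt (fun s ↦ primitiveSnd f x s) (f x y) y := by
  have hc : Continuous (f x) := hf.comp (Continuous.prodMk_right x)
  exact hc.integral_hasStrictDerivAt 0 y |>.hasDerivAt

theorem hasDerivAt_integral_param {f : ℝ → ℝ → ℂ} (hf : ContDiff ℝ 1 ↿f) (x a b : ℝ) :
    HasDerivAt (fun s ↦ ∫ t in a..b, f s t) (∫ t in a..b, partialFst f x t) x := by
  have hc1 : Continuous ↿(partialFst f) := (contDiff_partialFst (m := 0) hf (by simp)).continuous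
  obtain ⟨C, hC⟩ := ((isCompact_Icc (a := x - 1) (b := x + 1)).prod
    (isCompact_uIcc (a := a) (b := b))).exists_bound_of_continuousOn hc1.continuousOn
  have hcs (s : ℝ) : Continuous (f s) := hf.continuous.comp (Continuous.prodMk_right s)
  refine (intervalIntegral.hasDerivAt_integral_of_dominated_loc_of_deriv_le (bound := fun _ ↦ C)
    (Icc_mem_nhds (sub_one_lt x) (lt_add_one x)) (F' := partialFst f)
    (Eventually.of_forall fun s ↦ (hcs s).aestronglyMeasurable) ((hcs x).intervalIntegrable _ _)
    (hc1.comp (Continuous.prodMk_right x)).aestronglyMeasurable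
    (Eventually.of_forall fun t ht s hs ↦ hC (s, t) ⟨hs, uIoc_subset_uIcc ht⟩)
    intervalIntegrable_const
    (Eventually.of_forall fun t _ s _ ↦
      hasDerivAt_partialFst (hf.differentiable one_ne_zero) s t)).2

theorem continuous_primitiveSnd {f : ℝ → ℝ → ℂ} (hf : Continuous ↿f) :
    Continuous ↿(primitiveSnd f) :=
  intervalIntegral.continuous_parametric_primitive_of_continuous hf

/-- One partial of the primitive is `f`, the other is the primitive of `partialFst f`. Hence the
induction runs over all `f` at once. -/
theorem contDiff_primitiveSnd_nat (n : ℕ) : ∀ {f : ℝ → ℝ → ℂ}, ContDiff ℝ n ↿f →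
    ContDiff ℝ n ↿(primitiveSnd f) := by
  induction n with
  | zero =>
    intro f hf
    exact contDiff_zero.2 (continuous_primitiveSnd hf.continuous)
  | succ n ih =>
    intro f hf
    exact contDiff_succ_uncurry_of_partials
      (fun x y ↦ hasDerivAt_integral_param (hf.of_le (by simp)) x 0 y)
      (fun x y ↦ hasDerivAt_primitiveSnd_snd hf.continuous x y)
      (ih (contDiff_partialFst hf (by simp))) (hf.of_le (by simp))

theorem contDiff_primitiveSnd {f : ℝ → ℝ → ℂ} (hf : ContDiff ℝ ∞ ↿f) :
    ContDiff ℝ ∞ ↿(primitiveSnd f) :=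
  contDiff_infty.2 fun n ↦ contDiff_primitiveSnd_nat n (contDiff_infty.1 hf n)

theorem partialFst_primitiveSnd {f : ℝ → ℝ → ℂ} (hf : ContDiff ℝ 1 ↿f) (x y : ℝ) :
    partialFst (primitiveSnd f) x y = primitiveSnd (partialFst f) x y :=
  (hasDerivAt_integral_param hf x 0 y).deriv

theorem partialSnd_primitiveSnd {f : ℝ → ℝ → ℂ} (hf : Continuous ↿f) (x y : ℝ) :
    partialSnd (primitiveSnd f) x y = f x y :=
  (hasDerivAt_primitiveSnd_snd hf x y).deriv

theorem integral_eq_primitiveSnd_sub {f : ℝ → ℝ → ℂ} (hf : Continuous ↿f) (x a b : ℝ) :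
    ∫ t in a..b, f x t = primitiveSnd f x b - primitiveSnd f x a := by
  have hc : Continuous (f x) := hf.comp (Continuous.prodMk_right x)
  exact (intervalIntegral.integral_interval_sub_left (hc.intervalIntegrable _ _)
    (hc.intervalIntegrable _ _)).symm

/-- The Leibniz rule for an integral with variable limits. -/
theorem hasDerivAt_integral_variable_limits {f : ℝ → ℝ → ℂ} (hf : ContDiff ℝ ∞ ↿f) {g h : ℝ → ℝ}
    {g' h' x : ℝ} (hg : HasDerivAt g g' x) (hh : HasDerivAt h h' x) :
    HasDerivAt (fun s ↦ ∫ t in g s..h s, f s t)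
      (h' • f x (h x) - g' • f x (g x) + ∫ t in g x..h x, partialFst f x t) x := by
  have h1 : ContDiff ℝ 1 ↿f := hf.of_le (by simp)
  have hc1 : Continuous ↿(partialFst f) := (contDiff_partialFst (m := 0) h1 (by simp)).continuous
  have hd := (contDiff_primitiveSnd hf).differentiable (by simp)
  have e : (fun s ↦ ∫ t in g s..h s, f s t) =
      fun s ↦ primitiveSnd f s (h s) - primitiveSnd f s (g s) :=
    funext fun s ↦ integral_eq_primitiveSnd_sub hf.continuous s _ _
  rw [e, integral_eq_primitiveSnd_sub hc1]
  refine ((hasDerivAt_uncurry_comp hd (hasDerivAt_id x) hh).sub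
    (hasDerivAt_uncurry_comp hd (hasDerivAt_id x) hg)).congr_deriv ?_
  simp only [partialFst_primitiveSnd h1, partialSnd_primitiveSnd hf.continuous, id, one_smul]
  ring

theorem contDiff_integral_variable_limits {f : ℝ → ℝ → ℂ} (hf : ContDiff ℝ ∞ ↿f) {g h : ℝ → ℝ}
    (hg : ContDiff ℝ ∞ g) (hh : ContDiff ℝ ∞ h) :
    ContDiff ℝ ∞ (fun s ↦ ∫ t in g s..h s, f s t) := by
  have e : (fun s ↦ ∫ t in g s..h s, f s t) =
      fun s ↦ primitiveSnd f s (h s) - primitiveSnd f s (g s) :=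
    funext fun s ↦ integral_eq_primitiveSnd_sub hf.continuous s _ _
  rw [e]
  exact ((contDiff_primitiveSnd hf).comp (contDiff_id.prodMk hh)).sub
    ((contDiff_primitiveSnd hf).comp (contDiff_id.prodMk hg))

/-! ### The Goursat problem in integral form -/

/-- Each integration gains a power and a factor `1 / (n + 1)`; iterating produces the factorials in
the Picard bounds and in the injectivity of the transpose. -/
theorem norm_integral_le_of_norm_le_pow {f : ℝ → ℂ} {C u : ℝ} {n : ℕ}
    (h : ∀ α ∈ uIcc 0 u, ‖f α‖ ≤ C * |α| ^ n) :
    ‖∫ α in (0 : ℝ)..u, f α‖ ≤ C * (|u| ^ (n + 1) / (n + 1)) := by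
  have e : ∫ x in uIoc 0 u, C * |x| ^ n = C * (|u| ^ (n + 1) / (n + 1)) := by
    rw [integral_const_mul]
    simpa using congrArg (C * ·) (integral_pow_abs_sub_uIoc (a := 0) (b := u) n)
  rw [intervalIntegral.norm_intervalIntegral_eq, ← e]
  refine norm_integral_le_of_norm_le ?_ ?_
  · exact (Continuous.integrableOn_uIcc (by fun_prop)).mono_set uIoc_subset_uIcc
  · filter_upwards [ae_restrict_mem measurableSet_uIoc] with α hα
    exact h α (uIoc_subset_uIcc hα)

/-- The double integral `∫_0^u ∫_0^v Q H`. -/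
noncomputable def goursatOp (Q H : ℝ → ℝ → ℂ) (u v : ℝ) : ℂ :=
  ∫ α in (0 : ℝ)..u, ∫ β in (0 : ℝ)..v, Q α β * H α β

/-- Only the integration in `u` contributes to the factorial; the one in `v` is estimated crudely by
the length `L`. -/
theorem norm_goursatOp_le {Q H : ℝ → ℝ → ℂ} {u v M C L : ℝ} {n : ℕ} (hM : 0 ≤ M) (hv : |v| ≤ L)
    (hC : 0 ≤ C)
    (hQ : ∀ α ∈ uIcc 0 u, ∀ β ∈ uIcc 0 v, ‖Q α β‖ ≤ M)
    (hH : ∀ α ∈ uIcc 0 u, ∀ β ∈ uIcc 0 v, ‖H α β‖ ≤ C * ((M * L * |α|) ^ n / n.factorial)) :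
    ‖goursatOp Q H u v‖ ≤ C * ((M * L * |u|) ^ (n + 1) / (n + 1).factorial) := by
  have hL : 0 ≤ L := (abs_nonneg v).trans hv
  have h1 : ∀ α ∈ uIcc 0 u, ‖∫ β in (0 : ℝ)..v, Q α β * H α β‖ ≤
      (M * L * C * ((M * L) ^ n / n.factorial)) * |α| ^ n := by
    intro α hα
    refine (intervalIntegral.norm_integral_le_of_norm_le_const
      (C := M * (C * ((M * L * |α|) ^ n / n.factorial))) fun β hβ ↦ ?_).trans ?_
    · rw [norm_mul]
      exact mul_le_mul (hQ α hα β (uIoc_subset_uIcc hβ)) (hH α hα β (uIoc_subset_uIcc hβ))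
        (norm_nonneg _) hM
    · rw [sub_zero]
      refine (mul_le_mul_of_nonneg_left hv (by positivity)).trans_eq ?_
      rw [mul_pow]
      ring
  refine (norm_integral_le_of_norm_le_pow h1).trans_eq ?_
  rw [Nat.factorial_succ]
  push_cast
  have : ((n.factorial : ℕ) : ℝ) ≠ 0 := by positivity
  field_simp
  ring

/-- A bound for `H` on the rectangle improves under iteration of the equation to `C (M |v| |u|)^n /
n!`, which tends to `0`. -/
theorem eq_zero_of_eq_goursatOp {Q H : ℝ → ℝ → ℂ} {u v : ℝ}
    (hQ : ContinuousOn ↿Q (uIcc 0 u ×ˢ uIcc 0 v)) (hH : ContinuousOn ↿H (uIcc 0 u ×ˢ uIcc 0 v))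
    (h : ∀ α ∈ uIcc 0 u, ∀ β ∈ uIcc 0 v, H α β = goursatOp Q H α β) : H u v = 0 := by
  have hK : IsCompact (uIcc 0 u ×ˢ uIcc 0 v) := isCompact_uIcc.prod isCompact_uIcc
  obtain ⟨M, hM⟩ := hK.exists_bound_of_continuousOn hQ
  obtain ⟨C, hC⟩ := hK.exists_bound_of_continuousOn hH
  have hM0 : 0 ≤ M := (norm_nonneg _).trans (hM (0, 0) ⟨left_mem_uIcc, left_mem_uIcc⟩)
  have hC0 : 0 ≤ C := (norm_nonneg _).trans (hC (0, 0) ⟨left_mem_uIcc, left_mem_uIcc⟩)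
  have key (n : ℕ) : ∀ α ∈ uIcc 0 u, ∀ β ∈ uIcc 0 v,
      ‖H α β‖ ≤ C * ((M * |v| * |α|) ^ n / n.factorial) := by
    induction n with
    | zero =>
      intro α hα β hβ
      rw [pow_zero, Nat.factorial_zero, Nat.cast_one, div_one, mul_one]
      exact hC (α, β) ⟨hα, hβ⟩
    | succ n ih =>
      intro α hα β hβ
      rw [h α hα β hβ]
      have sα : uIcc 0 α ⊆ uIcc 0 u := uIcc_subset_uIcc left_mem_uIcc hα
      have sβ : uIcc 0 β ⊆ uIcc 0 v := uIcc_subset_uIcc left_mem_uIcc hβ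
      refine norm_goursatOp_le hM0 ?_ hC0 (fun α' hα' β' hβ' ↦ hM (α', β') ⟨sα hα', sβ hβ'⟩)
        (fun α' hα' β' hβ' ↦ ih α' (sα hα') β' (sβ hβ'))
      simpa using abs_sub_left_of_mem_uIcc hβ
  have lim : Tendsto (fun n : ℕ ↦ C * ((M * |v| * |u|) ^ n / n.factorial)) atTop (𝓝 0) := by
    simpa using (FloorSemiring.tendsto_pow_div_factorial_atTop (M * |v| * |u|)).const_mul C
  have := ge_of_tendsto' lim fun n ↦ key n u right_mem_uIcc v right_mem_uIcc
  simpa using this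

theorem continuous_goursatOp {Q H : ℝ → ℝ → ℂ} (hQ : Continuous ↿Q) (hH : Continuous ↿H) :
    Continuous ↿(goursatOp Q H) := by
  have h1 : Continuous ↿(primitiveSnd fun α β ↦ Q α β * H α β) :=
    continuous_primitiveSnd (hQ.mul hH)
  have h2 : Continuous ↿(primitiveSnd fun v α ↦ primitiveSnd (fun α β ↦ Q α β * H α β) α v) :=
    continuous_primitiveSnd (h1.comp continuous_swap)
  exact h2.comp continuous_swap

/-- The terms of the Picard series of the equation `H = g + ∫_0^u ∫_0^v Q H`. -/
noncomputable def picardTerm (Q : ℝ → ℝ → ℂ) (g : ℝ → ℂ) : ℕ → ℝ → ℝ → ℂ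
  | 0 => fun u _ ↦ g u
  | n + 1 => goursatOp Q (picardTerm Q g n)

theorem continuous_picardTerm {Q : ℝ → ℝ → ℂ} {g : ℝ → ℂ} (hQ : Continuous ↿Q)
    (hg : Continuous g) : ∀ n, Continuous ↿(picardTerm Q g n)
  | 0 => hg.comp continuous_fst
  | n + 1 => continuous_goursatOp hQ (continuous_picardTerm hQ hg n)

theorem exists_summable_bound_picardTerm {Q : ℝ → ℝ → ℂ} {g : ℝ → ℂ} (hQ : Continuous ↿Q)
    (hg : Continuous g) (R : ℝ) : ∃ b : ℕ → ℝ, Summable b ∧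
      ∀ n, ∀ u ∈ Icc (-R) R, ∀ v ∈ Icc (-R) R, ‖picardTerm Q g n u v‖ ≤ b n := by
  obtain hR | hR := lt_or_ge R 0
  · refine ⟨0, summable_zero, fun n u hu ↦ ?_⟩
    linarith [hu.1, hu.2]
  obtain ⟨M, hM⟩ := ((isCompact_Icc (a := -R) (b := R)).prod
    (isCompact_Icc (a := -R) (b := R))).exists_bound_of_continuousOn hQ.continuousOn
  obtain ⟨C, hC⟩ := (isCompact_Icc (a := -R) (b := R)).exists_bound_of_continuousOn hg.continuousOn
  have h0 : (0 : ℝ) ∈ Icc (-R) R := by constructor <;> linarith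
  have hM0 : 0 ≤ M := (norm_nonneg _).trans (hM (0, 0) ⟨h0, h0⟩)
  have hC0 : 0 ≤ C := (norm_nonneg _).trans (hC 0 h0)
  have sub : ∀ u ∈ Icc (-R) R, uIcc 0 u ⊆ Icc (-R) R := fun u hu ↦
    (uIcc_of_le (neg_le_self hR)) ▸ uIcc_subset_uIcc (Icc_subset_uIcc h0) (Icc_subset_uIcc hu)
  have key (n : ℕ) : ∀ u ∈ Icc (-R) R, ∀ v ∈ Icc (-R) R,
      ‖picardTerm Q g n u v‖ ≤ C * ((M * R * |u|) ^ n / n.factorial) := by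
    induction n with
    | zero =>
      intro u hu v hv
      rw [pow_zero, Nat.factorial_zero, Nat.cast_one, div_one, mul_one]
      exact hC u hu
    | succ n ih =>
      intro u hu v hv
      exact norm_goursatOp_le hM0 (abs_le.2 hv) hC0
        (fun α hα β hβ ↦ hM (α, β) ⟨sub u hu hα, sub v hv hβ⟩)
        (fun α hα β hβ ↦ ih α (sub u hu hα) β (sub v hv hβ))
  refine ⟨fun n ↦ C * ((M * R * R) ^ n / n.factorial),
    (Real.summable_pow_div_factorial _).mul_left C, fun n u hu v hv ↦ (key n u hu v hv).trans ?_⟩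
  have : |u| ≤ R := abs_le.2 hu
  change C * ((M * R * |u|) ^ n / n.factorial) ≤ C * ((M * R * R) ^ n / n.factorial)
  gcongr

/-- The Picard series converges uniformly on every square, so its sum is continuous, and dominated
convergence, once per integral, moves the sum through `goursatOp`. -/
theorem exists_continuous_goursat {Q : ℝ → ℝ → ℂ} {g : ℝ → ℂ} (hQ : Continuous ↿Q)
    (hg : Continuous g) :
    ∃ H : ℝ → ℝ → ℂ, Continuous ↿H ∧ ∀ u v, H u v = g u + goursatOp Q H u v := by
  have hc := continuous_picardTerm hQ hg
  have hc2 (n : ℕ) (α : ℝ) : Continuous fun β ↦ Q α β * picardTerm Q g n α β :=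
    (hQ.comp (Continuous.prodMk_right α)).mul ((hc n).comp (Continuous.prodMk_right α))
  have hs (u v : ℝ) : Summable fun n ↦ picardTerm Q g n u v := by
    obtain ⟨b, hb, h⟩ := exists_summable_bound_picardTerm hQ hg (max |u| |v|)
    exact Summable.of_norm_bounded hb fun n ↦ h n u (abs_le.1 (le_max_left _ _)) v
      (abs_le.1 (le_max_right _ _))
  refine ⟨fun u v ↦ ∑' n, picardTerm Q g n u v, ?_, fun u v ↦ ?_⟩
  · rw [continuous_iff_continuousAt]
    rintro ⟨u, v⟩
    -- The extra `1` puts `(u, v)` in the interior of the square.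
    set R := max |u| |v| + 1 with hRdef
    have hu : |u| < R := by linarith [le_max_left |u| |v|]
    have hv : |v| < R := by linarith [le_max_right |u| |v|]
    obtain ⟨b, hb, h⟩ := exists_summable_bound_picardTerm hQ hg R
    have : ContinuousOn (fun p : ℝ × ℝ ↦ ∑' n, picardTerm Q g n p.1 p.2)
        (Icc (-R) R ×ˢ Icc (-R) R) :=
      continuousOn_tsum (fun n ↦ (hc n).continuousOn) hb fun n p hp ↦ h n p.1 hp.1 p.2 hp.2
    exact this.continuousAt (prod_mem_nhds (Icc_mem_nhds (abs_lt.1 hu).1 (abs_lt.1 hu).2)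
      (Icc_mem_nhds (abs_lt.1 hv).1 (abs_lt.1 hv).2))
  · beta_reduce
    rw [(hs u v).tsum_eq_zero_add]
    congr 1
    set R := max |u| |v|
    have hR : 0 ≤ R := (abs_nonneg u).trans (le_max_left _ _)
    have h0 : (0 : ℝ) ∈ Icc (-R) R := by constructor <;> linarith
    have sub : ∀ u ∈ Icc (-R) R, uIoc 0 u ⊆ Icc (-R) R := fun u hu ↦
      uIoc_subset_uIcc.trans <| (uIcc_of_le (neg_le_self hR)) ▸
        uIcc_subset_uIcc (Icc_subset_uIcc h0) (Icc_subset_uIcc hu)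
    have su := sub u (abs_le.1 (le_max_left _ _))
    have sv := sub v (abs_le.1 (le_max_right _ _))
    obtain ⟨b, hb, h⟩ := exists_summable_bound_picardTerm hQ hg R
    obtain ⟨M, hM⟩ := ((isCompact_Icc (a := -R) (b := R)).prod
      (isCompact_Icc (a := -R) (b := R))).exists_bound_of_continuousOn hQ.continuousOn
    have hM0 : 0 ≤ M := (norm_nonneg _).trans (hM (0, 0) ⟨h0, h0⟩)
    have bound (n : ℕ) (α : ℝ) (hα : α ∈ uIoc 0 u) (β : ℝ) (hβ : β ∈ uIoc 0 v) :
        ‖Q α β * picardTerm Q g n α β‖ ≤ M * b n := by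
      rw [norm_mul]
      exact mul_le_mul (hM (α, β) ⟨su hα, sv hβ⟩) (h n α (su hα) β (sv hβ)) (norm_nonneg _) hM0
    have inner (α : ℝ) (hα : α ∈ uIoc 0 u) :
        HasSum (fun n ↦ ∫ β in (0 : ℝ)..v, Q α β * picardTerm Q g n α β)
          (∫ β in (0 : ℝ)..v, Q α β * ∑' n, picardTerm Q g n α β) :=
      intervalIntegral.hasSum_integral_of_dominated_convergence (fun n _ ↦ M * b n)
        (fun n ↦ (hc2 n α).aestronglyMeasurable)
        (fun n ↦ Eventually.of_forall fun β hβ ↦ bound n α hα β hβ)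
        (Eventually.of_forall fun _ _ ↦ hb.mul_left M) intervalIntegrable_const
        (Eventually.of_forall fun β _ ↦ (hs α β).hasSum.mul_left _)
    have hm (n : ℕ) : Continuous fun α ↦ ∫ β in (0 : ℝ)..v, Q α β * picardTerm Q g n α β :=
      (continuous_primitiveSnd (f := fun α β ↦ Q α β * picardTerm Q g n α β)
        (hQ.mul (hc n))).comp (Continuous.prodMk_left v)
    have outer : HasSum (fun n ↦ goursatOp Q (picardTerm Q g n) u v)
        (goursatOp Q (fun u v ↦ ∑' n, picardTerm Q g n u v) u v) :=
      intervalIntegral.hasSum_integral_of_dominated_convergence (fun n _ ↦ M * b n * |v - 0|)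
        (fun n ↦ (hm n).aestronglyMeasurable)
        (fun n ↦ Eventually.of_forall fun α hα ↦
          intervalIntegral.norm_integral_le_of_norm_le_const fun β hβ ↦ bound n α hα β hβ)
        (Eventually.of_forall fun _ _ ↦ (hb.mul_left M).mul_right _) intervalIntegrable_const
        (Eventually.of_forall fun α hα ↦ inner α hα)
    exact outer.tsum_eq

theorem goursatOp_eq_swap {Q H : ℝ → ℝ → ℂ} (hQ : Continuous ↿Q) (hH : Continuous ↿H) (u v : ℝ) :
    goursatOp Q H u v = ∫ β in (0 : ℝ)..v, ∫ α in (0 : ℝ)..u, Q α β * H α β := by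
  refine intervalIntegral_intervalIntegral_swap (F := fun α β ↦ Q α β * H α β) ?_
  have hc : Continuous (fun α β ↦ Q α β * H α β).uncurry := hQ.mul hH
  exact (hc.continuousOn.integrableOn_compact (isCompact_uIcc.prod isCompact_uIcc)).mono_set
    (prod_mono uIoc_subset_uIcc uIoc_subset_uIcc)

section GoursatRegularity

variable {Q H : ℝ → ℝ → ℂ} {g g' : ℝ → ℂ}

theorem hasDerivAt_goursat_fst (hQ : Continuous ↿Q) (hHc : Continuous ↿H)
    (hg : ∀ u, HasDerivAt g (g' u) u) (hH : ∀ u v, H u v = g u + goursatOp Q H u v) (u v : ℝ) :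
    HasDerivAt (fun s ↦ H s v) (g' u + primitiveSnd (fun α β ↦ Q α β * H α β) u v) u := by
  have hp : Continuous fun α ↦ primitiveSnd (fun α β ↦ Q α β * H α β) α v :=
    (continuous_primitiveSnd (f := fun α β ↦ Q α β * H α β) (hQ.mul hHc)).comp
      (Continuous.prodMk_left v)
  rw [show (fun s ↦ H s v) = fun s ↦ g s + goursatOp Q H s v from funext fun s ↦ hH s v]
  exact (hg u).add (hp.integral_hasStrictDerivAt 0 u).hasDerivAt

theorem hasDerivAt_goursat_snd (hQ : Continuous ↿Q) (hHc : Continuous ↿H)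
    (hH : ∀ u v, H u v = g u + goursatOp Q H u v) (u v : ℝ) :
    HasDerivAt (fun s ↦ H u s) (primitiveSnd (fun β α ↦ Q α β * H α β) v u) v := by
  have hp : Continuous fun β ↦ primitiveSnd (fun β α ↦ Q α β * H α β) β u :=
    (continuous_primitiveSnd (f := fun β α ↦ Q α β * H α β)
      ((hQ.mul hHc).comp continuous_swap)).comp (Continuous.prodMk_left u)
  rw [show (fun s ↦ H u s) = fun s ↦ g u + ∫ β in (0 : ℝ)..s, ∫ α in (0 : ℝ)..u, Q α β * H α β
    from funext fun s ↦ by rw [hH u s, goursatOp_eq_swap hQ hHc]]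
  exact (hp.integral_hasStrictDerivAt 0 v).hasDerivAt.const_add _

/-- Bootstrapping: the partials of `H` are `g'` plus a primitive of `Q H`, and a primitive of `Q H`
in the other variable. Both are as smooth as `H` is already known to be, so `H` has one derivative
more. -/
theorem contDiff_goursat (hQ : ContDiff ℝ ∞ ↿Q) (hHc : Continuous ↿H) (hg' : ContDiff ℝ ∞ g')
    (hg : ∀ u, HasDerivAt g (g' u) u) (hH : ∀ u v, H u v = g u + goursatOp Q H u v) :
    ContDiff ℝ ∞ ↿H := by
  refine contDiff_infty.2 fun n ↦ ?_
  induction n with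
  | zero => exact contDiff_zero.2 hHc
  | succ n ih =>
    have hP : ContDiff ℝ n ↿(fun α β ↦ Q α β * H α β) := (contDiff_infty.1 hQ n).mul ih
    refine contDiff_succ_uncurry_of_partials
      (hasDerivAt_goursat_fst hQ.continuous hHc hg hH)
      (f₂ := fun u v ↦ primitiveSnd (fun β α ↦ Q α β * H α β) v u)
      (hasDerivAt_goursat_snd hQ.continuous hHc hH) ?_ ?_
    · exact ((contDiff_infty.1 hg' n).comp contDiff_fst).add (contDiff_primitiveSnd_nat n hP)
    · exact (contDiff_primitiveSnd_nat n (f := fun β α ↦ Q α β * H α β)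
        (hP.comp (contDiff_snd.prodMk contDiff_fst))).comp (contDiff_snd.prodMk contDiff_fst)

theorem partialSnd_partialFst_goursat (hQ : Continuous ↿Q) (hHc : Continuous ↿H)
    (hg : ∀ u, HasDerivAt g (g' u) u) (hH : ∀ u v, H u v = g u + goursatOp Q H u v) (u v : ℝ) :
    partialSnd (partialFst H) u v = Q u v * H u v := by
  have e : partialFst H = fun u v ↦ g' u + primitiveSnd (fun α β ↦ Q α β * H α β) u v :=
    funext₂ fun u v ↦ (hasDerivAt_goursat_fst hQ hHc hg hH u v).deriv
  rw [e]
  exact ((hasDerivAt_primitiveSnd_snd (f := fun α β ↦ Q α β * H α β)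
    (hQ.mul hHc) u v).const_add _).deriv

theorem partialFst_partialSnd_goursat (hQ : Continuous ↿Q) (hHc : Continuous ↿H)
    (hH : ∀ u v, H u v = g u + goursatOp Q H u v) (u v : ℝ) :
    partialFst (partialSnd H) u v = Q u v * H u v := by
  have e : partialSnd H = fun u v ↦ primitiveSnd (fun β α ↦ Q α β * H α β) v u :=
    funext₂ fun u v ↦ (hasDerivAt_goursat_snd hQ hHc hH u v).deriv
  rw [e]
  exact (hasDerivAt_primitiveSnd_snd (f := fun β α ↦ Q α β * H α β)
    ((hQ.mul hHc).comp continuous_swap) v u).deriv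

end GoursatRegularity

/-! ### Uniqueness for the Goursat problem -/

theorem goursatOp_congr {Q Q' H H' : ℝ → ℝ → ℂ} {u v : ℝ}
    (hQ : ∀ α ∈ uIcc 0 u, ∀ β ∈ uIcc 0 v, Q α β = Q' α β)
    (hH : ∀ α ∈ uIcc 0 u, ∀ β ∈ uIcc 0 v, H α β = H' α β) :
    goursatOp Q H u v = goursatOp Q' H' u v :=
  intervalIntegral.integral_congr fun α hα ↦ intervalIntegral.integral_congr fun β hβ ↦ by
    simp only [hQ α hα β hβ, hH α hα β hβ]

theorem goursatOp_sub {Q H H' : ℝ → ℝ → ℂ} (hQ : Continuous ↿Q) (hH : Continuous ↿H)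
    (hH' : Continuous ↿H') (u v : ℝ) :
    goursatOp Q (fun α β ↦ H α β - H' α β) u v = goursatOp Q H u v - goursatOp Q H' u v := by
  have hc (F : ℝ → ℝ → ℂ) (hF : Continuous ↿F) (α : ℝ) : Continuous fun β ↦ Q α β * F α β :=
    (hQ.comp (Continuous.prodMk_right α)).mul (hF.comp (Continuous.prodMk_right α))
  have hp (F : ℝ → ℝ → ℂ) (hF : Continuous ↿F) :
      Continuous fun α ↦ ∫ β in (0 : ℝ)..v, Q α β * F α β :=
    (continuous_primitiveSnd (f := fun α β ↦ Q α β * F α β) (hQ.mul hF)).comp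
      (Continuous.prodMk_left v)
  unfold goursatOp
  rw [← intervalIntegral.integral_sub ((hp H hH).intervalIntegrable _ _)
    ((hp H' hH').intervalIntegrable _ _)]
  congr 1
  ext α
  rw [← intervalIntegral.integral_sub ((hc H hH α).intervalIntegrable _ _)
    ((hc H' hH' α).intervalIntegrable _ _)]
  simp only [mul_sub]

/-- Clamping each coordinate to its interval extends a function continuously from the rectangle to
the plane, so that lemmas about globally continuous functions apply. -/
theorem exists_continuous_eqOn_box {F : ℝ → ℝ → ℂ} {u v : ℝ}
    (hF : ContinuousOn ↿F (uIcc 0 u ×ˢ uIcc 0 v)) :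
    ∃ G : ℝ → ℝ → ℂ, Continuous ↿G ∧ ∀ α ∈ uIcc 0 u, ∀ β ∈ uIcc 0 v, F α β = G α β := by
  let c (w x : ℝ) : ℝ := max (min 0 w) (min (max 0 w) x)
  have hc (w : ℝ) : Continuous (c w) := by fun_prop
  have hmem (w x : ℝ) : c w x ∈ uIcc 0 w :=
    ⟨le_max_left _ _, max_le min_le_max (min_le_left _ _)⟩
  have hid (w x : ℝ) (hx : x ∈ uIcc 0 w) : c w x = x := by
    have h1 : min 0 w ≤ x := hx.1
    have h2 : x ≤ max 0 w := hx.2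
    simp [c, h1, h2]
  refine ⟨fun α β ↦ F (c u α) (c v β), ?_, fun α hα β hβ ↦ by
    beta_reduce
    rw [hid u α hα, hid v β hβ]⟩
  exact hF.comp_continuous (((hc u).comp continuous_fst).prodMk ((hc v).comp continuous_snd))
    fun p ↦ ⟨hmem _ _, hmem _ _⟩

/-- The difference of the two solutions solves the homogeneous equation. The data need to agree only
on the rectangle, which allows solutions for different extensions of `q` to be compared. -/
theorem goursat_unique {Q Q' H H' : ℝ → ℝ → ℂ} {g g' : ℝ → ℂ} {u v : ℝ}
    (hQ : ContinuousOn ↿Q (uIcc 0 u ×ˢ uIcc 0 v)) (hH : ContinuousOn ↿H (uIcc 0 u ×ˢ uIcc 0 v))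
    (hH' : ContinuousOn ↿H' (uIcc 0 u ×ˢ uIcc 0 v))
    (hQQ' : ∀ α ∈ uIcc 0 u, ∀ β ∈ uIcc 0 v, Q α β = Q' α β) (hgg' : ∀ α ∈ uIcc 0 u, g α = g' α)
    (h : ∀ α ∈ uIcc 0 u, ∀ β ∈ uIcc 0 v, H α β = g α + goursatOp Q H α β)
    (h' : ∀ α ∈ uIcc 0 u, ∀ β ∈ uIcc 0 v, H' α β = g' α + goursatOp Q' H' α β) :
    H u v = H' u v := by
  obtain ⟨P, hPc, hP⟩ := exists_continuous_eqOn_box hQ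
  obtain ⟨G, hGc, hG⟩ := exists_continuous_eqOn_box hH
  obtain ⟨G', hGc', hG'⟩ := exists_continuous_eqOn_box hH'
  rw [← sub_eq_zero]
  refine eq_zero_of_eq_goursatOp (Q := Q) (H := fun α β ↦ H α β - H' α β) hQ (hH.sub hH')
    fun α hα β hβ ↦ ?_
  have sα : uIcc 0 α ⊆ uIcc 0 u := uIcc_subset_uIcc left_mem_uIcc hα
  have sβ : uIcc 0 β ⊆ uIcc 0 v := uIcc_subset_uIcc left_mem_uIcc hβ
  have e1 : goursatOp Q H α β = goursatOp P G α β :=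
    goursatOp_congr (fun α hα β hβ ↦ hP α (sα hα) β (sβ hβ))
      (fun α hα β hβ ↦ hG α (sα hα) β (sβ hβ))
  have e2 : goursatOp Q' H' α β = goursatOp P G' α β :=
    goursatOp_congr (fun α hα β hβ ↦ by rw [← hQQ' α (sα hα) β (sβ hβ), hP α (sα hα) β (sβ hβ)])
      (fun α hα β hβ ↦ hG' α (sα hα) β (sβ hβ))
  have e3 : goursatOp Q (fun α β ↦ H α β - H' α β) α β =
      goursatOp P (fun α β ↦ G α β - G' α β) α β :=
    goursatOp_congr (fun α hα β hβ ↦ hP α (sα hα) β (sβ hβ)) (fun α hα β hβ ↦ by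
      rw [hG α (sα hα) β (sβ hβ), hG' α (sα hα) β (sβ hβ)])
  rw [e3, goursatOp_sub hPc hGc hGc', h α hα β hβ, h' α hα β hβ, e1, e2, hgg' α hα]
  ring

/-! ### Transmutation kernels -/

/-- A smooth kernel on the plane such that `f ↦ f(x) + ∫_{-x}^x K(x, t) f(t) dt` intertwines
`d²/dx² - q₂` and `d²/dx² - q₁`. -/
structure IsTransmutationKernel (q₁ q₂ : ℝ → ℂ) (K : ℝ → ℝ → ℂ) : Prop where
  contDiff : ContDiff ℝ ∞ ↿K
  wave : ∀ x t, partialFst (partialFst K) x t - partialSnd (partialSnd K) x t =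
    (q₁ x - q₂ t) * K x t
  antidiag : ∀ x, K x (-x) = 0
  diag : ∀ x, HasDerivAt (fun x ↦ K x x) ((q₁ x - q₂ x) / 2) x

/-- With `u = (x + t) / 2` and `v = (x - t) / 2`, the difference `K_xx - K_tt` is half the sum of
the two mixed partials of `H`, each equal to `Q H`. The diagonal is `v = 0`, where only `g`
survives, and the antidiagonal is `u = 0`, where `g 0 = 0`. -/
theorem isTransmutationKernel_of_goursat {Q H : ℝ → ℝ → ℂ} {g q₁ q₂ : ℝ → ℂ}
    (hQ : ContDiff ℝ ∞ ↿Q) (hHc : Continuous ↿H)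
    (hq : ContDiff ℝ ∞ fun x ↦ q₁ x - q₂ x) (hQq : ∀ x t, Q ((x + t) / 2) ((x - t) / 2) = q₁ x - q₂ t)
    (hg0 : g 0 = 0) (hg : ∀ u, HasDerivAt g ((q₁ u - q₂ u) / 2) u)
    (hH : ∀ u v, H u v = g u + goursatOp Q H u v) :
    IsTransmutationKernel q₁ q₂ fun x t ↦ H ((x + t) / 2) ((x - t) / 2) := by
  have hs : ContDiff ℝ ∞ ↿H := contDiff_goursat hQ hHc (hq.div_const 2) hg hH
  have hd := hs.differentiable (by simp)
  have hd1 : Differentiable ℝ ↿(partialFst H) :=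
    (contDiff_partialFst (m := ∞) hs (by simp)).differentiable (by simp)
  have hd2 : Differentiable ℝ ↿(partialSnd H) :=
    (contDiff_partialSnd (m := ∞) hs (by simp)).differentiable (by simp)
  have d1 (t x : ℝ) : HasDerivAt (fun x ↦ (x + t) / 2) (1 / 2) x :=
    ((hasDerivAt_id x).add_const t).div_const 2
  have d2 (t x : ℝ) : HasDerivAt (fun x ↦ (x - t) / 2) (1 / 2) x :=
    ((hasDerivAt_id x).sub_const t).div_const 2
  have d3 (x t : ℝ) : HasDerivAt (fun t ↦ (x + t) / 2) (1 / 2) t :=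
    ((hasDerivAt_id t).const_add x).div_const 2
  have d4 (x t : ℝ) : HasDerivAt (fun t ↦ (x - t) / 2) (-1 / 2) t :=
    ((hasDerivAt_id t).const_sub x).div_const 2
  have e1 : partialFst (fun x t ↦ H ((x + t) / 2) ((x - t) / 2)) = fun x t ↦
      (1 / 2 : ℝ) • partialFst H ((x + t) / 2) ((x - t) / 2) +
        (1 / 2 : ℝ) • partialSnd H ((x + t) / 2) ((x - t) / 2) :=
    funext₂ fun x t ↦ (hasDerivAt_uncurry_comp hd (d1 t x) (d2 t x)).deriv
  have e2 : partialSnd (fun x t ↦ H ((x + t) / 2) ((x - t) / 2)) = fun x t ↦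
      (1 / 2 : ℝ) • partialFst H ((x + t) / 2) ((x - t) / 2) +
        (-1 / 2 : ℝ) • partialSnd H ((x + t) / 2) ((x - t) / 2) :=
    funext₂ fun x t ↦ (hasDerivAt_uncurry_comp hd (d3 x t) (d4 x t)).deriv
  refine ⟨?_, fun x t ↦ ?_, fun x ↦ ?_, fun x ↦ ?_⟩
  · exact hs.comp (((contDiff_fst.add contDiff_snd).div_const 2).prodMk
      ((contDiff_fst.sub contDiff_snd).div_const 2))
  · have f1 := (((hasDerivAt_uncurry_comp hd1 (d1 t x) (d2 t x)).const_smul (1 / 2 : ℝ)).add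
      ((hasDerivAt_uncurry_comp hd2 (d1 t x) (d2 t x)).const_smul (1 / 2 : ℝ))).deriv
    have f2 := (((hasDerivAt_uncurry_comp hd1 (d3 x t) (d4 x t)).const_smul (1 / 2 : ℝ)).add
      ((hasDerivAt_uncurry_comp hd2 (d3 x t) (d4 x t)).const_smul (-1 / 2 : ℝ))).deriv
    rw [e1, e2]
    refine (congrArg₂ (· - ·) f1 f2).trans ?_
    rw [partialSnd_partialFst_goursat hQ.continuous hHc hg hH,
      partialFst_partialSnd_goursat hQ.continuous hHc hH, hQq]
    simp only [Complex.real_smul]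
    push_cast
    ring
  · rw [hH]
    simp [hg0, goursatOp]
  · have : (fun x ↦ H ((x + x) / 2) ((x - x) / 2)) = g := by
      ext x
      rw [hH]
      simp [goursatOp]
    rw [this]
    exact hg x

/-! ### The Volterra operator on smooth functions -/

theorem contDiff_volterra {K : ℝ → ℝ → ℂ} {f : ℝ → ℂ} (hK : ContDiff ℝ ∞ ↿K)
    (hf : ContDiff ℝ ∞ f) : ContDiff ℝ ∞ (volterra K f) :=
  hf.add (contDiff_integral_variable_limits (f := fun x t ↦ K x t * f t)
    (hK.mul (hf.comp contDiff_snd)) contDiff_neg contDiff_id)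

theorem partialFst_mul_snd {K : ℝ → ℝ → ℂ} {f : ℝ → ℂ} (hK : Differentiable ℝ ↿K) :
    partialFst (fun x t ↦ K x t * f t) = fun x t ↦ partialFst K x t * f t :=
  funext₂ fun x t ↦ ((hasDerivAt_partialFst hK x t).mul_const (f t)).deriv

theorem hasDerivAt_integral_symm_mul {K : ℝ → ℝ → ℂ} {f : ℝ → ℂ} (hK : ContDiff ℝ ∞ ↿K)
    (hf : ContDiff ℝ ∞ f) (x : ℝ) :
    HasDerivAt (fun x ↦ ∫ t in (-x)..x, K x t * f t)
      (K x x * f x + K x (-x) * f (-x) + ∫ t in (-x)..x, partialFst K x t * f t) x := by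
  have := hasDerivAt_integral_variable_limits (f := fun x t ↦ K x t * f t)
    (hK.mul (hf.comp contDiff_snd)) (hasDerivAt_neg x) (hasDerivAt_id x)
  rw [partialFst_mul_snd (hK.differentiable (by simp))] at this
  refine this.congr_deriv ?_
  simp

namespace IsTransmutationKernel

variable {q₁ q₂ : ℝ → ℂ} {K : ℝ → ℝ → ℂ} {f : ℝ → ℂ}

theorem partialFst_add_partialSnd_diag (h : IsTransmutationKernel q₁ q₂ K) (x : ℝ) :
    partialFst K x x + partialSnd K x x = (q₁ x - q₂ x) / 2 := by
  have := hasDerivAt_uncurry_comp (h.contDiff.differentiable (by simp)) (hasDerivAt_id x)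
    (hasDerivAt_id x)
  simpa using this.unique (h.diag x)

theorem partialFst_sub_partialSnd_antidiag (h : IsTransmutationKernel q₁ q₂ K) (x : ℝ) :
    partialFst K x (-x) - partialSnd K x (-x) = 0 := by
  have h1 := hasDerivAt_uncurry_comp (h.contDiff.differentiable (by simp)) (hasDerivAt_id x)
    (hasDerivAt_neg x)
  have h2 : (fun s ↦ K (id s) (-s)) = fun _ ↦ 0 := funext fun s ↦ h.antidiag s
  rw [h2] at h1
  simpa [sub_eq_add_neg] using h1.unique (hasDerivAt_const x 0)

/-- Two integrations by parts at once: `K_t f - K f'` is an antiderivative of `K_tt f - K f''`. The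
boundary term with `f'(-x)` drops out because `K` vanishes on the antidiagonal. -/
theorem integral_partialSnd_partialSnd (h : IsTransmutationKernel q₁ q₂ K)
    (hf : ContDiff ℝ ∞ f) (x : ℝ) :
    ∫ t in (-x)..x, partialSnd (partialSnd K) x t * f t =
      partialSnd K x x * f x - partialSnd K x (-x) * f (-x) - K x x * deriv f x +
        ∫ t in (-x)..x, K x t * deriv (deriv f) t := by
  have hK2 : ContDiff ℝ ∞ ↿(partialSnd K) := contDiff_partialSnd h.contDiff (by simp)
  have hK22 : ContDiff ℝ ∞ ↿(partialSnd (partialSnd K)) := contDiff_partialSnd hK2 (by simp)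
  have hf1 : ContDiff ℝ ∞ (deriv f) := (contDiff_infty_iff_deriv.1 hf).2
  have hf2 : ContDiff ℝ ∞ (deriv (deriv f)) := (contDiff_infty_iff_deriv.1 hf1).2
  have c1 : Continuous fun t ↦ partialSnd (partialSnd K) x t * f t :=
    (hK22.continuous.comp (Continuous.prodMk_right x)).mul hf.continuous
  have c2 : Continuous fun t ↦ K x t * deriv (deriv f) t :=
    (h.contDiff.continuous.comp (Continuous.prodMk_right x)).mul hf2.continuous
  have key := intervalIntegral.integral_eq_sub_of_hasDerivAt (a := -x) (b := x)
    (f := fun t ↦ partialSnd K x t * f t - K x t * deriv f t)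
    (f' := fun t ↦ partialSnd (partialSnd K) x t * f t - K x t * deriv (deriv f) t)
    (fun t _ ↦ ?_) ((c1.sub c2).intervalIntegrable _ _)
  · rw [intervalIntegral.integral_sub (c1.intervalIntegrable _ _) (c2.intervalIntegrable _ _),
      h.antidiag] at key
    linear_combination key
  · have g1 := (hasDerivAt_partialSnd (hK2.differentiable (by simp)) x t).mul
      ((hf.differentiable (by simp)) t).hasDerivAt
    have g2 := (hasDerivAt_partialSnd (h.contDiff.differentiable (by simp)) x t).mul
      ((hf1.differentiable (by simp)) t).hasDerivAt
    refine (g1.sub g2).congr_deriv ?_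
    ring

theorem hasDerivAt_volterra (h : IsTransmutationKernel q₁ q₂ K) (hf : ContDiff ℝ ∞ f) (x : ℝ) :
    HasDerivAt (volterra K f)
      (deriv f x + (K x x * f x + ∫ t in (-x)..x, partialFst K x t * f t)) x := by
  refine (((hf.differentiable (by simp)) x).hasDerivAt.add
    (hasDerivAt_integral_symm_mul h.contDiff hf x)).congr_deriv ?_
  rw [h.antidiag]
  ring

/-- The wave equation trades `K_xx` for `K_tt`, which is integrated by parts. Of the boundary terms,
those with `f'(x)` cancel, those with `f(-x)` cancel by the antidiagonal condition, and those with
`f(x)` add up to `(q₁ - q₂) f`: one half from the derivative of `K x x`, the other from the sum of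
the partials. -/
theorem deriv_deriv_volterra (h : IsTransmutationKernel q₁ q₂ K) (hq₂ : Continuous q₂)
    (hf : ContDiff ℝ ∞ f) (x : ℝ) :
    deriv (deriv (volterra K f)) x = q₁ x * volterra K f x +
      volterra K (fun y ↦ deriv (deriv f) y - q₂ y * f y) x := by
  have hK1 : ContDiff ℝ ∞ ↿(partialFst K) := contDiff_partialFst h.contDiff (by simp)
  have hf1 : ContDiff ℝ ∞ (deriv f) := (contDiff_infty_iff_deriv.1 hf).2
  have hf2 : ContDiff ℝ ∞ (deriv (deriv f)) := (contDiff_infty_iff_deriv.1 hf1).2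
  have e : deriv (volterra K f) = fun x ↦
      deriv f x + (K x x * f x + ∫ t in (-x)..x, partialFst K x t * f t) :=
    funext fun x ↦ (h.hasDerivAt_volterra hf x).deriv
  have hd := ((hf1.differentiable (by simp)) x).hasDerivAt.add
    (((h.diag x).mul ((hf.differentiable (by simp)) x).hasDerivAt).add
      (hasDerivAt_integral_symm_mul hK1 hf x))
  have cK (g : ℝ → ℂ) (hg : Continuous g) : Continuous fun t ↦ K x t * g t :=
    (h.contDiff.continuous.comp (Continuous.prodMk_right x)).mul hg
  have i11 : ∫ t in (-x)..x, partialFst (partialFst K) x t * f t =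
      (∫ t in (-x)..x, partialSnd (partialSnd K) x t * f t) +
        (q₁ x * (∫ t in (-x)..x, K x t * f t) - ∫ t in (-x)..x, K x t * (q₂ t * f t)) := by
    have hK2 : ContDiff ℝ ∞ ↿(partialSnd K) := contDiff_partialSnd h.contDiff (by simp)
    have hK22 : ContDiff ℝ ∞ ↿(partialSnd (partialSnd K)) := contDiff_partialSnd hK2 (by simp)
    have c22 : Continuous fun t ↦ partialSnd (partialSnd K) x t * f t :=
      (hK22.continuous.comp (Continuous.prodMk_right x)).mul hf.continuous
    have c0 := cK f hf.continuous
    have cq := cK (fun t ↦ q₂ t * f t) (hq₂.mul hf.continuous)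
    have c3 : Continuous fun t ↦ q₁ x * (K x t * f t) - K x t * (q₂ t * f t) :=
      (c0.const_mul _).sub cq
    rw [← intervalIntegral.integral_const_mul, ← intervalIntegral.integral_sub
      ((c0.const_mul _).intervalIntegrable _ _) (cq.intervalIntegrable _ _),
      ← intervalIntegral.integral_add (c22.intervalIntegrable _ _)
      (c3.intervalIntegrable _ _)]
    congr 1
    ext t
    linear_combination f t * h.wave x t
  have isub : ∫ t in (-x)..x, K x t * (deriv (deriv f) t - q₂ t * f t) =
      (∫ t in (-x)..x, K x t * deriv (deriv f) t) - ∫ t in (-x)..x, K x t * (q₂ t * f t) := by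
    rw [← intervalIntegral.integral_sub ((cK _ hf2.continuous).intervalIntegrable _ _)
      ((cK (fun t ↦ q₂ t * f t) (hq₂.mul hf.continuous)).intervalIntegrable _ _)]
    simp only [mul_sub]
  rw [e]
  refine hd.deriv.trans ?_
  rw [i11, h.integral_partialSnd_partialSnd hf]
  unfold volterra
  rw [isub]
  linear_combination f x * h.partialFst_add_partialSnd_diag x +
    f (-x) * h.partialFst_sub_partialSnd_antidiag x

theorem volterra_zero (K : ℝ → ℝ → ℂ) (f : ℝ → ℂ) : volterra K f 0 = f 0 := by
  simp [volterra]

theorem deriv_volterra_zero (h : IsTransmutationKernel q₁ q₂ K) (hf : ContDiff ℝ ∞ f) :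
    deriv (volterra K f) 0 = deriv f 0 := by
  have := h.antidiag 0
  rw [neg_zero] at this
  rw [(h.hasDerivAt_volterra hf 0).deriv, this]
  simp

end IsTransmutationKernel

/-! ### Composition of the two Volterra operators on monomials -/

theorem eq_zero_of_deriv_deriv_eq_zero {y : ℝ → ℂ} (hy : ContDiff ℝ ∞ y)
    (h2 : ∀ x, deriv (deriv y) x = 0) (h0 : y 0 = 0) (h1 : deriv y 0 = 0) (x : ℝ) : y x = 0 := by
  have hy1 : ContDiff ℝ ∞ (deriv y) := (contDiff_infty_iff_deriv.1 hy).2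
  have e1 (x : ℝ) : deriv y x = 0 :=
    (is_const_of_deriv_eq_zero (hy1.differentiable (by simp)) h2 x 0).trans h1
  exact (is_const_of_deriv_eq_zero (hy.differentiable (by simp)) e1 x 0).trans h0

theorem deriv_deriv_ofReal_pow (n : ℕ) :
    deriv (deriv fun x : ℝ ↦ (x : ℂ) ^ n) =
      fun x : ℝ ↦ (n * (n - 1 : ℕ) : ℂ) * (x : ℂ) ^ (n - 2) := by
  have h (m : ℕ) (x : ℝ) : HasDerivAt (fun x : ℝ ↦ (x : ℂ) ^ m) (m * (x : ℂ) ^ (m - 1)) x :=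
    (hasDerivAt_pow m (x : ℂ)).comp_ofReal
  have e : deriv (fun x : ℝ ↦ (x : ℂ) ^ n) = fun x : ℝ ↦ (n : ℂ) * (x : ℂ) ^ (n - 1) :=
    funext fun x ↦ (h n x).deriv
  rw [e]
  ext x
  rw [((h (n - 1) x).const_mul (n : ℂ)).deriv, Nat.sub_sub, mul_assoc]

theorem contDiff_ofReal_pow (n : ℕ) : ContDiff ℝ ∞ fun x : ℝ ↦ (x : ℂ) ^ n :=
  Complex.ofRealCLM.contDiff.pow n

theorem volterra_const_mul (K : ℝ → ℝ → ℂ) (c : ℂ) (f : ℝ → ℂ) (x : ℝ) :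
    volterra K (fun t ↦ c * f t) x = c * volterra K f x := by
  unfold volterra
  rw [mul_add, ← intervalIntegral.integral_const_mul]
  simp only [mul_left_comm]

/-- The Volterra operators that intertwine `d²/dx²` and `d²/dx² - q` in the two directions compose
to the identity on polynomials. -/
theorem volterra_volterra_pow {q : ℝ → ℂ} {K L : ℝ → ℝ → ℂ} (hq : ContDiff ℝ ∞ q)
    (hK : IsTransmutationKernel q 0 K) (hL : IsTransmutationKernel 0 q L) (n : ℕ) (x : ℝ) :
    volterra L (volterra K fun x ↦ (x : ℂ) ^ n) x = (x : ℂ) ^ n := by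
  -- The composition commutes with `d²/dx²`: the potential introduced by `K` is removed by `L`.
  have main (f : ℝ → ℂ) (hf : ContDiff ℝ ∞ f) (x : ℝ) :
      deriv (deriv (volterra L (volterra K f))) x =
        volterra L (volterra K (deriv (deriv f))) x := by
    rw [hL.deriv_deriv_volterra hq.continuous (contDiff_volterra hK.contDiff hf)]
    have : (fun y ↦ deriv (deriv (volterra K f)) y - q y * volterra K f y) =
        volterra K (deriv (deriv f)) := by
      ext y
      rw [hK.deriv_deriv_volterra continuous_zero hf]
      simp
    rw [this]
    simp
  -- The second derivative of `x^n` is a multiple of `x^(n-2)`, which is fixed by induction. The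
  -- difference to be shown zero thus has zero second derivative and zero Cauchy data at `0`.
  induction n using Nat.strong_induction_on generalizing x with
  | _ n ih =>
  have hp := contDiff_ofReal_pow n
  have hc := contDiff_volterra hL.contDiff (contDiff_volterra hK.contDiff hp)
  have hp1 : ContDiff ℝ ∞ (deriv fun x : ℝ ↦ (x : ℂ) ^ n) := (contDiff_infty_iff_deriv.1 hp).2
  have hc1 := (contDiff_infty_iff_deriv.1 hc).2
  have e : deriv (fun x ↦ volterra L (volterra K fun x ↦ (x : ℂ) ^ n) x - (x : ℂ) ^ n) = fun x ↦
      deriv (volterra L (volterra K fun x ↦ (x : ℂ) ^ n)) x - deriv (fun x : ℝ ↦ (x : ℂ) ^ n) x :=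
    funext fun x ↦ deriv_fun_sub (hc.differentiable (by simp) x) (hp.differentiable (by simp) x)
  refine sub_eq_zero.1 (eq_zero_of_deriv_deriv_eq_zero
    (y := fun x ↦ volterra L (volterra K fun x ↦ (x : ℂ) ^ n) x - (x : ℂ) ^ n)
    (hc.sub hp) (fun x ↦ ?_) ?_ ?_ x)
  · rw [e, deriv_fun_sub (hc1.differentiable (by simp) x) (hp1.differentiable (by simp) x),
      main _ hp, deriv_deriv_ofReal_pow]
    have e2 : volterra K (fun x : ℝ ↦ (n * (n - 1 : ℕ) : ℂ) * (x : ℂ) ^ (n - 2)) = fun x ↦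
        (n * (n - 1 : ℕ) : ℂ) * volterra K (fun x ↦ (x : ℂ) ^ (n - 2)) x :=
      funext fun x ↦ volterra_const_mul _ _ _ _
    rw [e2, volterra_const_mul]
    -- For `n < 2` the exponent `n - 2` is truncated, but the coefficient `n (n - 1)` vanishes.
    obtain hn | hn := Nat.eq_zero_or_pos n
    · simp [hn]
    · obtain hn | hn := Nat.lt_or_ge n 2
      · obtain rfl : n = 1 := by omega
        simp
      · rw [ih (n - 2) (by omega), sub_self]
  · simp [IsTransmutationKernel.volterra_zero]
  · rw [e]
    beta_reduce
    rw [hL.deriv_volterra_zero (contDiff_volterra hK.contDiff hp), hK.deriv_volterra_zero hp,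
      sub_self]

/-! ### Duality between the Volterra operator and its transpose -/

/-- The sign with which the point `t` enters the integral `∫_{-x}^x`. -/
noncomputable def symSign (x t : ℝ) : ℂ := if |t| < x then 1 else if |t| < -x then -1 else 0

theorem symSign_eq_zero {x t : ℝ} (h : |x| ≤ |t|) : symSign x t = 0 := by
  rw [symSign, if_neg (not_lt.2 ((le_abs_self x).trans h)),
    if_neg (not_lt.2 ((neg_le_abs x).trans h))]

theorem norm_symSign_le (x t : ℝ) : ‖symSign x t‖ ≤ 1 := by
  unfold symSign
  split_ifs <;> simp

theorem measurable_symSign : Measurable fun p : ℝ × ℝ ↦ symSign p.1 p.2 := by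
  refine Measurable.ite ?_ measurable_const (Measurable.ite ?_ measurable_const measurable_const)
  · exact measurableSet_lt measurable_snd.abs measurable_fst
  · exact measurableSet_lt measurable_snd.abs measurable_fst.neg

/-- Writing the oriented integral as one over the whole line, with a sign depending on both
variables, prepares for Fubini. -/
theorem integral_symSign_mul_snd (g : ℝ → ℂ) (x : ℝ) :
    ∫ t, symSign x t * g t = ∫ t in (-x)..x, g t := by
  obtain hx | hx := le_total 0 x
  · rw [intervalIntegral.integral_of_le (by linarith), integral_Ioc_eq_integral_Ioo,
      ← integral_indicator measurableSet_Ioo]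
    congr 1
    ext t
    by_cases h : |t| < x
    · rw [indicator_of_mem (s := Ioo (-x) x) (abs_lt.1 h), symSign, if_pos h, one_mul]
    · rw [indicator_of_notMem (s := Ioo (-x) x) (fun h' ↦ h (abs_lt.2 h')), symSign, if_neg h,
        if_neg (by linarith [abs_nonneg t]), zero_mul]
  · rw [intervalIntegral.integral_symm, intervalIntegral.integral_of_le (by linarith),
      integral_Ioc_eq_integral_Ioo, ← integral_indicator measurableSet_Ioo, ← integral_neg]
    congr 1
    ext t
    have h1 : ¬ |t| < x := by linarith [abs_nonneg t]
    by_cases h : |t| < -x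
    · have := abs_lt.1 h
      rw [neg_neg] at this
      rw [indicator_of_mem (s := Ioo x (-x)) this, symSign, if_neg h1, if_pos h, neg_one_mul]
    · rw [indicator_of_notMem (s := Ioo x (-x)) (fun h' ↦ h (abs_lt.2 (by simpa using h'))), symSign, if_neg h1,
        if_neg h, zero_mul, neg_zero]

theorem integral_symSign_mul_fst {g : ℝ → ℂ} (hg : Integrable g) (t : ℝ) :
    ∫ x, symSign x t * g x = (∫ x in Ioi |t|, g x) - ∫ x in Iio (-|t|), g x := by
  rw [← integral_indicator measurableSet_Ioi, ← integral_indicator measurableSet_Iio,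
    ← integral_sub (hg.indicator measurableSet_Ioi) (hg.indicator measurableSet_Iio)]
  congr 1
  ext x
  by_cases h : |t| < x
  · have h2 : ¬ x < -|t| := by linarith [abs_nonneg t]
    rw [indicator_of_mem (mem_Ioi.2 h), indicator_of_notMem (by simpa using h2), symSign, if_pos h]
    ring
  · rw [indicator_of_notMem (by simpa using h), symSign, if_neg h]
    by_cases h' : |t| < -x
    · rw [if_pos h', indicator_of_mem (mem_Iio.2 (by linarith))]
      ring
    · rw [if_neg h', indicator_of_notMem (by rw [mem_Iio]; linarith)]
      ring

/-- The integrals use `K t x` only with `|x| ≤ |t|`, and `φ t` vanishes unless `|t| ≤ r`. When `|x|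
> a` the intervals are reversed, but they lie outside the support of `φ` since `r < a`. -/
theorem volterraTranspose_congr {a r : ℝ} (hra : r < a) {k K : ℝ → ℝ → ℂ} {φ : ℝ → ℂ}
    (hφ : ∀ x ∉ Icc (-r) r, φ x = 0)
    (hkK : ∀ x ∈ Icc (-r) r, ∀ t ∈ Icc (-r) r, k x t = K x t) (x : ℝ) :
    volterraTranspose a k φ x = volterraTranspose a K φ x := by
  have key (t : ℝ) (ht : t ∈ Icc (-r) r → |x| ≤ |t|) : k t x * φ t = K t x * φ t := by
    by_cases h : t ∈ Icc (-r) r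
    · rw [hkK t h x (abs_le.1 ((ht h).trans (abs_le.2 h)))]
    · rw [hφ t h, mul_zero, mul_zero]
  unfold volterraTranspose
  rw [intervalIntegral.integral_congr (g := fun t ↦ K t x * φ t) fun t ht ↦ key t fun h ↦ ?_,
    intervalIntegral.integral_congr (g := fun t ↦ K t x * φ t) fun t ht ↦ key t fun h ↦ ?_]
  · obtain h1 | h1 := le_total |x| a
    · rw [uIcc_of_le h1] at ht
      exact ht.1.trans (le_abs_self t)
    · rw [uIcc_of_ge h1] at ht
      linarith [h.2, ht.1]
  · obtain h1 | h1 := le_total |x| a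
    · rw [uIcc_of_le (neg_le_neg h1)] at ht
      linarith [ht.2, neg_le_abs t]
    · rw [uIcc_of_ge (neg_le_neg h1)] at ht
      linarith [h.1, ht.2]

section Duality

variable {r : ℝ} {K : ℝ → ℝ → ℂ} {φ f : ℝ → ℂ}

theorem integrable_of_continuous_of_eq_zero (hφc : Continuous φ)
    (hφ : ∀ x ∉ Icc (-r) r, φ x = 0) : Integrable φ :=
  hφc.integrable_of_hasCompactSupport (HasCompactSupport.intro isCompact_Icc hφ)

theorem volterraTranspose_eq_integral {a : ℝ} (hra : r ≤ a) (hK : Continuous ↿K)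
    (hφc : Continuous φ) (hφ : ∀ x ∉ Icc (-r) r, φ x = 0) (t : ℝ) :
    volterraTranspose a K φ t = φ t + ∫ x, symSign x t * (K x t * φ x) := by
  have hc : Continuous fun x ↦ K x t * φ x := (hK.comp (Continuous.prodMk_left t)).mul hφc
  have h0 : ∀ x ∉ Icc (-r) r, K x t * φ x = 0 := fun x hx ↦ by rw [hφ x hx, mul_zero]
  have hi := integrable_of_continuous_of_eq_zero hc h0
  rw [integral_symSign_mul_fst hi, volterraTranspose]
  have e1 : ∫ x in |t|..a, K x t * φ x = ∫ x in Ioi |t|, K x t * φ x := by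
    rw [← intervalIntegral.integral_Ioi_sub_Ioi' hi.integrableOn hi.integrableOn,
      setIntegral_eq_zero_of_forall_eq_zero (t := Ioi a), sub_zero]
    exact fun x hx ↦ h0 x fun h ↦ by linarith [h.2, mem_Ioi.1 hx]
  have e2 : ∫ x in (-a)..(-|t|), K x t * φ x = ∫ x in Iio (-|t|), K x t * φ x := by
    rw [← intervalIntegral.integral_Iic_sub_Iic hi.integrableOn hi.integrableOn,
      integral_Iic_eq_integral_Iio, integral_Iic_eq_integral_Iio,
      setIntegral_eq_zero_of_forall_eq_zero (t := Iio (-a)), sub_zero]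
    exact fun x hx ↦ h0 x fun h ↦ by linarith [h.1, mem_Iio.1 hx]
  rw [e1, e2]
  ring

/-- For `|t| > r` the sign vanishes at every `x` in `[-r, r]`, so no support is created outside
`[-r, r]`. -/
theorem volterraTranspose_eq_zero {a : ℝ} (hra : r ≤ a) (hK : Continuous ↿K)
    (hφc : Continuous φ) (hφ : ∀ x ∉ Icc (-r) r, φ x = 0) {t : ℝ} (ht : t ∉ Icc (-r) r) :
    volterraTranspose a K φ t = 0 := by
  rw [volterraTranspose_eq_integral hra hK hφc hφ, hφ t ht, zero_add]
  refine integral_eq_zero_of_ae (Eventually.of_forall fun x ↦ ?_)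
  by_cases hx : x ∈ Icc (-r) r
  · have : r < |t| := by
      by_contra h
      exact ht (abs_le.1 (not_lt.1 h))
    simp [symSign_eq_zero ((abs_le.2 hx).trans this.le)]
  · simp [hφ x hx]

/-- A continuous kernel is bounded only on the square, so it is cut off there; the product is
unchanged because `φ` and `f` vanish outside `[-r, r]`. -/
theorem integrable_symSign_kernel_mul (hK : Continuous ↿K) (hφi : Integrable φ) (hfi : Integrable f)
    (hφ : ∀ x ∉ Icc (-r) r, φ x = 0) (hf : ∀ x ∉ Icc (-r) r, f x = 0) :
    Integrable (Function.uncurry fun x t ↦ symSign x t * (K x t * (φ x * f t)))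
      (volume.prod volume) := by
  have hcpt : IsCompact (Icc (-r) r ×ˢ Icc (-r) r) := isCompact_Icc.prod isCompact_Icc
  obtain ⟨M, hM⟩ := hcpt.exists_bound_of_continuousOn hK.continuousOn
  have hmeas : Measurable fun p : ℝ × ℝ ↦
      (Icc (-r) r ×ˢ Icc (-r) r).indicator (fun p ↦ symSign p.1 p.2 * ↿K p) p :=
    (measurable_symSign.mul hK.measurable).indicator hcpt.measurableSet
  refine ((hφi.mul_prod hfi).bdd_mul (c := max M 0) hmeas.aestronglyMeasurable
    (Eventually.of_forall fun p ↦ ?_)).congr (Eventually.of_forall fun p ↦ ?_)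
  · by_cases hp : p ∈ Icc (-r) r ×ˢ Icc (-r) r
    · rw [indicator_of_mem hp, norm_mul]
      exact (mul_le_of_le_one_left (norm_nonneg _) (norm_symSign_le _ _)).trans
        ((hM p hp).trans (le_max_left _ _))
    · rw [indicator_of_notMem hp, norm_zero]
      exact le_max_right _ _
  · by_cases hp : p ∈ Icc (-r) r ×ˢ Icc (-r) r
    · change (Icc (-r) r ×ˢ Icc (-r) r).indicator (fun p ↦ symSign p.1 p.2 * ↿K p) p * _ = _
      rw [indicator_of_mem hp, mul_assoc]
      rfl
    · change (Icc (-r) r ×ˢ Icc (-r) r).indicator (fun p ↦ symSign p.1 p.2 * ↿K p) p * _ = _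
      rw [indicator_of_notMem hp, zero_mul]
      simp only [Function.uncurry]
      obtain h | h := not_and_or.1 hp
      · simp [hφ _ h]
      · simp [hf _ h]

theorem integral_symSign_kernel_mul_snd (hφ : ∀ x ∉ Icc (-r) r, φ x = 0) (x : ℝ) :
    ∫ t, symSign x t * (K x t * (φ x * (Icc (-r) r).indicator f t)) =
      φ x * ∫ t in (-x)..x, K x t * f t := by
  by_cases hx : x ∈ Icc (-r) r
  · rw [← integral_symSign_mul_snd, ← integral_const_mul]
    congr 1
    ext t
    by_cases ht : t ∈ Icc (-r) r
    · rw [indicator_of_mem ht]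
      ring
    · have : r < |t| := by
        by_contra h
        exact ht (abs_le.1 (not_lt.1 h))
      rw [symSign_eq_zero ((abs_le.2 hx).trans this.le)]
      ring
  · simp [hφ x hx]

theorem integrable_mul_integral_kernel (hK : Continuous ↿K) (hφi : Integrable φ)
    (hφ : ∀ x ∉ Icc (-r) r, φ x = 0) (hf : IntegrableOn f (Icc (-r) r)) :
    Integrable fun x ↦ φ x * ∫ t in (-x)..x, K x t * f t := by
  have := (integrable_symSign_kernel_mul hK hφi (hf.integrable_indicator measurableSet_Icc) hφ
    fun x hx ↦ indicator_of_notMem hx f).integral_prod_left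
  refine this.congr (Eventually.of_forall fun x ↦ ?_)
  exact integral_symSign_kernel_mul_snd hφ x

theorem integrableOn_volterra (hK : Continuous ↿K) (hf : IntegrableOn f (Icc (-r) r)) :
    IntegrableOn (volterra K f) (Icc (-r) r) := by
  refine hf.add ?_
  -- Taking `φ` to be the indicator of the interval turns integrability of the product into
  -- integrability on `[-r, r]`.
  have := integrable_mul_integral_kernel (φ := (Icc (-r) r).indicator 1) hK
    ((integrable_indicator_iff measurableSet_Icc).2 (continuous_one.integrableOn_Icc))
    (fun x hx ↦ indicator_of_notMem hx _) hf
  rw [← integrable_indicator_iff measurableSet_Icc]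
  refine this.congr (Eventually.of_forall fun x ↦ ?_)
  by_cases hx : x ∈ Icc (-r) r <;> simp [hx]

/-- The transpose of the Volterra operator with respect to the pairing `∫ f φ`. -/
theorem integral_mul_volterra {a : ℝ} (hra : r ≤ a) (hK : Continuous ↿K) (hφc : Continuous φ)
    (hφ : ∀ x ∉ Icc (-r) r, φ x = 0) (hf : IntegrableOn f (Icc (-r) r)) :
    ∫ x, φ x * volterra K f x = ∫ x, volterraTranspose a K φ x * f x := by
  have hφi := integrable_of_continuous_of_eq_zero hφc hφ
  have hΦ := integrable_symSign_kernel_mul hK hφi (hf.integrable_indicator measurableSet_Icc) hφ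
    fun x hx ↦ indicator_of_notMem hx f
  have hφf : Integrable fun x ↦ φ x * f x := by
    have hM : ∃ M, ∀ x, ‖φ x‖ ≤ M :=
      hφc.bounded_above_of_compact_support (HasCompactSupport.intro isCompact_Icc hφ)
    obtain ⟨M, hM⟩ := hM
    refine ((hf.integrable_indicator measurableSet_Icc).bdd_mul (c := M)
      hφc.aestronglyMeasurable (Eventually.of_forall hM)).congr (Eventually.of_forall fun x ↦ ?_)
    by_cases hx : x ∈ Icc (-r) r
    · simp [hx]
    · simp [hx, hφ x hx]
  have e (t : ℝ) : ∫ x, symSign x t * (K x t * (φ x * (Icc (-r) r).indicator f t)) =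
      (volterraTranspose a K φ t - φ t) * f t := by
    by_cases ht : t ∈ Icc (-r) r
    · rw [volterraTranspose_eq_integral hra hK hφc hφ, add_sub_cancel_left, indicator_of_mem ht,
        ← integral_mul_const]
      simp only [mul_assoc]
    · rw [volterraTranspose_eq_zero hra hK hφc hφ ht, hφ t ht]
      simp [ht]
  have hr : Integrable fun t ↦ (volterraTranspose a K φ t - φ t) * f t :=
    hΦ.integral_prod_right.congr (Eventually.of_forall e)
  have swap := integral_integral_swap hΦ
  simp only [e, integral_symSign_kernel_mul_snd hφ] at swap
  calc ∫ x, φ x * volterra K f x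
      = ∫ x, (φ x * f x + φ x * ∫ t in (-x)..x, K x t * f t) := by simp only [volterra, mul_add]
    _ = (∫ x, φ x * f x) + ∫ t, (volterraTranspose a K φ t - φ t) * f t := by
        rw [integral_add hφf (integrable_mul_integral_kernel hK hφi hφ hf), swap]
    _ = ∫ x, volterraTranspose a K φ x * f x := by
        rw [← integral_add hφf hr]
        congr 1
        ext x
        ring

end Duality

/-- A continuous function with compact support all of whose moments vanish is zero. -/
theorem eq_zero_of_forall_integral_mul_pow_eq_zero {r : ℝ} {φ : ℝ → ℂ} (hφc : Continuous φ)
    (hφ : ∀ x ∉ Icc (-r) r, φ x = 0) (h : ∀ n : ℕ, ∫ x, φ x * (x : ℂ) ^ n = 0) : φ = 0 := by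
  have hφi := integrable_of_continuous_of_eq_zero hφc hφ
  have hmul (g : ℝ → ℝ) (hg : Continuous g) : Integrable fun x ↦ φ x * (g x : ℂ) :=
    integrable_of_continuous_of_eq_zero (r := r) (hφc.mul (Complex.continuous_ofReal.comp hg))
      fun x hx ↦ by simp [hφ x hx]
  have hpoly (p : Polynomial ℝ) : ∫ x, φ x * ((p.eval x : ℝ) : ℂ) = 0 := by
    have e (x : ℝ) : φ x * ((p.eval x : ℝ) : ℂ) =
        ∑ i ∈ Finset.range (p.natDegree + 1), (p.coeff i : ℂ) * (φ x * (x : ℂ) ^ i) := by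
      rw [Polynomial.eval_eq_sum_range, Complex.ofReal_sum, Finset.mul_sum]
      refine Finset.sum_congr rfl fun i _ ↦ ?_
      push_cast
      ring
    simp only [e]
    rw [integral_finsetSum]
    · simp only [integral_const_mul, h, mul_zero, Finset.sum_const_zero]
    · intro i _
      have := hmul (fun x ↦ x ^ i) (by fun_prop)
      push_cast at this
      exact this.const_mul _
  -- Weierstrass approximation on `[-r, r]`. The tolerance is divided by `I + 1` instead of `I`
  -- because `I` may be zero.
  have hcont (g : ℝ → ℝ) (hg : Continuous g) : ∫ x, φ x * (g x : ℂ) = 0 := by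
    rw [← norm_eq_zero]
    refine le_antisymm (le_of_forall_pos_le_add fun ε hε ↦ ?_) (norm_nonneg _)
    set I := ∫ x, ‖φ x‖
    have hI : 0 ≤ I := integral_nonneg fun x ↦ norm_nonneg _
    have hδ : 0 < ε / (I + 1) := by positivity
    obtain ⟨p, hp⟩ := exists_polynomial_near_of_continuousOn (-r) r g hg.continuousOn _ hδ
    have e : ∫ x, φ x * (g x : ℂ) = ∫ x, φ x * ((g x - p.eval x : ℝ) : ℂ) := by
      rw [← sub_zero (∫ x, φ x * (g x : ℂ)), ← hpoly p, ← integral_sub (hmul g hg)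
        (hmul _ p.continuous)]
      congr 1
      ext x
      push_cast
      ring
    rw [e, zero_add]
    calc ‖∫ x, φ x * ((g x - p.eval x : ℝ) : ℂ)‖ ≤ ∫ x, ‖φ x‖ * (ε / (I + 1)) := by
          refine norm_integral_le_of_norm_le (hφi.norm.mul_const _)
            (Eventually.of_forall fun x ↦ ?_)
          by_cases hx : x ∈ Icc (-r) r
          · rw [norm_mul, Complex.norm_real, Real.norm_eq_abs, abs_sub_comm]
            exact mul_le_mul_of_nonneg_left (hp x hx).le (norm_nonneg _)
          · simp [hφ x hx]
      _ = I * (ε / (I + 1)) := integral_mul_const _ _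
      _ ≤ ε := by
          rw [mul_div_assoc', div_le_iff₀ (by positivity)]
          nlinarith
  have hae := ae_eq_zero_of_integral_contDiff_smul_eq_zero hφi.locallyIntegrable fun g hg _ ↦ by
    rw [← hcont g hg.continuous]
    congr 1
    ext x
    rw [Complex.real_smul, mul_comm]
  exact (hφc.ae_eq_iff_eq volume continuous_zero).1 hae

/-! ### The transposed operator on smooth functions -/

/-- The integral part of the transposed operator, with both integrals folded into one. -/
noncomputable def transposeIntegral (a : ℝ) (K : ℝ → ℝ → ℂ) (φ : ℝ → ℂ) (x : ℝ) : ℂ :=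
  ∫ t in x..a, (K t x * φ t - K (-t) x * φ (-t))

section

variable {a r : ℝ} {K L : ℝ → ℝ → ℂ} {φ ψ : ℝ → ℂ}

theorem continuous_transposeIntegrand (hK : Continuous ↿K) (hφ : Continuous φ) (x : ℝ) :
    Continuous fun t ↦ K t x * φ t - K (-t) x * φ (-t) := by
  have h : Continuous fun t ↦ K t x * φ t := (hK.comp (Continuous.prodMk_left x)).mul hφ
  exact h.sub (h.comp continuous_neg)

/-- The folded integrand is odd in `t`, so its integral over `[-x, x]` vanishes. This removes the
absolute value from the limit, after which smoothness at `0` is evident. -/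
theorem transposeIntegral_abs (hK : Continuous ↿K) (hφ : Continuous φ) (x : ℝ) :
    transposeIntegral a K φ x = ∫ t in |x|..a, (K t x * φ t - K (-t) x * φ (-t)) := by
  obtain h | h := abs_choice x
  · rw [h, transposeIntegral]
  · have hc := continuous_transposeIntegrand hK hφ x
    have e := intervalIntegral.integral_comp_neg (a := -x) (b := x)
      (fun t ↦ K t x * φ t - K (-t) x * φ (-t))
    have e' : ∫ t in (-x)..x, (K (-t) x * φ (-t) - K (-(-t)) x * φ (-(-t))) =
        -∫ t in (-x)..x, (K t x * φ t - K (-t) x * φ (-t)) := by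
      rw [← intervalIntegral.integral_neg]
      simp only [neg_neg, neg_sub]
    rw [e', neg_neg] at e
    have z : ∫ t in (-x)..x, (K t x * φ t - K (-t) x * φ (-t)) = 0 := self_eq_neg.1 e.symm
    rw [h, transposeIntegral, ← intervalIntegral.integral_add_adjacent_intervals
      (hc.intervalIntegrable (-x) x) (hc.intervalIntegrable x a), z, zero_add]

theorem volterraTranspose_eq_add (hK : Continuous ↿K) (hφ : Continuous φ) (x : ℝ) :
    volterraTranspose a K φ x = φ x + transposeIntegral a K φ x := by
  have h : Continuous fun t ↦ K t x * φ t := (hK.comp (Continuous.prodMk_left x)).mul hφ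
  have h' : Continuous fun t ↦ K (-t) x * φ (-t) := h.comp continuous_neg
  rw [transposeIntegral_abs hK hφ, intervalIntegral.integral_sub (h.intervalIntegrable _ _)
    (h'.intervalIntegrable _ _), intervalIntegral.integral_comp_neg (fun t ↦ K t x * φ t),
    volterraTranspose]
  ring

theorem contDiff_transposeIntegrand (hK : ContDiff ℝ ∞ ↿K) (hφ : ContDiff ℝ ∞ φ) :
    ContDiff ℝ ∞ ↿(fun x t ↦ K t x * φ t - K (-t) x * φ (-t)) :=
  ((hK.comp (contDiff_snd.prodMk contDiff_fst)).mul (hφ.comp contDiff_snd)).sub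
    ((hK.comp (contDiff_snd.neg.prodMk contDiff_fst)).mul (hφ.comp contDiff_snd.neg))

theorem contDiff_transposeIntegral (hK : ContDiff ℝ ∞ ↿K) (hφ : ContDiff ℝ ∞ φ) :
    ContDiff ℝ ∞ (transposeIntegral a K φ) :=
  contDiff_integral_variable_limits (contDiff_transposeIntegrand hK hφ) contDiff_id contDiff_const

theorem contDiff_volterraTranspose (hK : ContDiff ℝ ∞ ↿K) (hφ : ContDiff ℝ ∞ φ) :
    ContDiff ℝ ∞ (volterraTranspose a K φ) := by
  rw [show volterraTranspose a K φ = fun x ↦ φ x + transposeIntegral a K φ x from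
    funext fun x ↦ volterraTranspose_eq_add hK.continuous hφ.continuous x]
  exact hφ.add (contDiff_transposeIntegral hK hφ)

/-- The derivative is an operator of the same type with kernel `partialSnd K`, up to multiplications
by smooth functions and a reflection. This closes the induction for the seminorm bounds. -/
theorem deriv_transposeIntegral (hK : ContDiff ℝ ∞ ↿K) (hφ : ContDiff ℝ ∞ φ) :
    deriv (transposeIntegral a K φ) = fun x ↦
      transposeIntegral a (partialSnd K) φ x - (φ x * K x x - φ (-x) * K (-x) x) := by
  ext x
  have h := hasDerivAt_integral_variable_limits (contDiff_transposeIntegrand hK hφ)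
    (hasDerivAt_id x) (hasDerivAt_const x a)
  have hd := hK.differentiable (by simp)
  have e (t : ℝ) : partialFst (fun x t ↦ K t x * φ t - K (-t) x * φ (-t)) x t =
      partialSnd K t x * φ t - partialSnd K (-t) x * φ (-t) :=
    (((hasDerivAt_partialSnd hd t x).mul_const (φ t)).sub
      ((hasDerivAt_partialSnd hd (-t) x).mul_const (φ (-t)))).deriv
  refine h.deriv.trans ?_
  simp only [e, id, transposeIntegral]
  simp only [zero_smul, one_smul]
  ring

theorem volterraTranspose_sub (hK : Continuous ↿K) (hφ : Continuous φ) (hψ : Continuous ψ)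
    (x : ℝ) : volterraTranspose a K (φ - ψ) x =
      volterraTranspose a K φ x - volterraTranspose a K ψ x := by
  rw [volterraTranspose_eq_add hK (hφ.sub hψ), volterraTranspose_eq_add hK hφ,
    volterraTranspose_eq_add hK hψ]
  have : transposeIntegral a K (φ - ψ) x =
      transposeIntegral a K φ x - transposeIntegral a K ψ x := by
    unfold transposeIntegral
    rw [← intervalIntegral.integral_sub
      ((continuous_transposeIntegrand hK hφ x).intervalIntegrable _ _)
      ((continuous_transposeIntegrand hK hψ x).intervalIntegrable _ _)]
    congr 1
    ext t
    simp only [Pi.sub_apply]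
    ring
  rw [this, Pi.sub_apply]
  ring

/-- The equation expresses `φ x` by its values at `t` and `-t` with `|x| ≤ t ≤ r`. Iterating gains
powers of the distance `r - |x|` to the end of the interval, with factorial denominators. -/
theorem eq_zero_of_volterraTranspose_eq_zero (hra : r ≤ a) (hK : Continuous ↿K)
    (hφc : Continuous φ) (hφ : ∀ x ∉ Icc (-r) r, φ x = 0)
    (h : ∀ x, volterraTranspose a K φ x = 0) : φ = 0 := by
  obtain ⟨M, hM⟩ := ((isCompact_Icc (a := -r) (b := r)).prod
    (isCompact_Icc (a := -r) (b := r))).exists_bound_of_continuousOn hK.continuousOn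
  obtain ⟨C, hC⟩ := (isCompact_Icc (a := -r) (b := r)).exists_bound_of_continuousOn
    hφc.continuousOn
  -- The endpoint `a` may be lowered to `r`, so that all points of integration stay where `K` is
  -- bounded by `M`.
  have hr (x : ℝ) : volterraTranspose r K φ x = 0 := by
    rw [← h x, volterraTranspose_eq_integral le_rfl hK hφc hφ,
      volterraTranspose_eq_integral hra hK hφc hφ]
  have key (n : ℕ) : ∀ x ∈ Icc (-r) r, ‖φ x‖ ≤ C * ((2 * M) ^ n / n.factorial) * (r - |x|) ^ n := by
    induction n with
    | zero => simpa using hC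
    | succ n ih =>
      intro x hx
      have hxr : |x| ≤ r := abs_le.2 hx
      have hM0 : 0 ≤ M := (norm_nonneg _).trans (hM (x, x) ⟨hx, hx⟩)
      have e := hr x
      rw [volterraTranspose_eq_add hK hφc, transposeIntegral_abs hK hφc] at e
      rw [eq_neg_of_add_eq_zero_left e, norm_neg]
      -- The substitution `t = r - s` measures the distance from the endpoint, so the power estimate
      -- applies on `[0, r - |x|]`.
      have sub := intervalIntegral.integral_comp_sub_left (a := 0) (b := r - |x|)
        (fun t ↦ K t x * φ t - K (-t) x * φ (-t)) r
      rw [sub_sub_cancel, sub_zero] at sub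
      rw [← sub]
      refine (norm_integral_le_of_norm_le_pow (n := n)
        (C := 2 * M * (C * ((2 * M) ^ n / n.factorial))) fun s hs ↦ ?_).trans_eq ?_
      · rw [uIcc_of_le (by linarith)] at hs
        have hs1 : s ≤ r := by linarith [hs.2, abs_nonneg x]
        have m1 : r - s ∈ Icc (-r) r := ⟨by linarith [hs.1], by linarith [hs.1]⟩
        have m2 : -(r - s) ∈ Icc (-r) r := ⟨by linarith [m1.2], by linarith [m1.1]⟩
        have i1 := ih _ m1
        have i2 := ih _ m2
        rw [abs_neg] at i2
        rw [abs_of_nonneg (by linarith : 0 ≤ r - s), sub_sub_cancel] at i1 i2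
        rw [abs_of_nonneg hs.1]
        refine (norm_sub_le _ _).trans ?_
        rw [norm_mul, norm_mul]
        have b1 := mul_le_mul (hM (r - s, x) ⟨m1, hx⟩) i1 (norm_nonneg _) hM0
        have b2 := mul_le_mul (hM (-(r - s), x) ⟨m2, hx⟩) i2 (norm_nonneg _) hM0
        exact (add_le_add b1 b2).trans_eq (by ring)
      · rw [abs_of_nonneg (by linarith : 0 ≤ r - |x|), Nat.factorial_succ]
        push_cast
        have : ((n.factorial : ℕ) : ℝ) ≠ 0 := by positivity
        field_simp
        ring
  ext x
  by_cases hx : x ∈ Icc (-r) r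
  · have lim : Tendsto (fun n : ℕ ↦ C * ((2 * M) ^ n / n.factorial) * (r - |x|) ^ n) atTop
        (𝓝 0) := by
      have := (FloorSemiring.tendsto_pow_div_factorial_atTop (2 * M * (r - |x|))).const_mul C
      rw [mul_zero] at this
      refine this.congr fun n ↦ ?_
      rw [mul_pow]
      ring
    simpa using ge_of_tendsto' lim fun n ↦ key n x hx
  · exact hφ x hx

theorem deriv_eq_zero_of_notMem_Icc (hφ : ∀ x ∉ Icc (-r) r, φ x = 0) :
    ∀ x ∉ Icc (-r) r, deriv φ x = 0 := by
  intro x hx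
  have : φ =ᶠ[𝓝 x] fun _ ↦ 0 := by
    filter_upwards [isClosed_Icc.isOpen_compl.mem_nhds hx] with y hy using hφ y hy
  rw [this.deriv_eq, deriv_const]

theorem integral_deriv_mul_eq_neg {g : ℝ → ℂ} (hφs : ContDiff ℝ ∞ φ)
    (hφ : ∀ x ∉ Icc (-r) r, φ x = 0) (hg : ContDiff ℝ ∞ g) :
    ∫ x, deriv φ x * g x = -∫ x, φ x * deriv g x := by
  have hφ1 := (contDiff_infty_iff_deriv.1 hφs).2
  have hg1 := (contDiff_infty_iff_deriv.1 hg).2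
  have hi {u v : ℝ → ℂ} (hu : Continuous u) (hv : Continuous v)
      (h0 : ∀ x ∉ Icc (-r) r, u x = 0) : Integrable (u * v) :=
    integrable_of_continuous_of_eq_zero (r := r) (hu.mul hv) fun x hx ↦ by simp [h0 x hx]
  rw [integral_mul_deriv_eq_deriv_mul_of_integrable
    (fun x _ ↦ (hφs.differentiable (by simp) x).hasDerivAt)
    (fun x _ ↦ (hg.differentiable (by simp) x).hasDerivAt)
    (hi hφs.continuous hg1.continuous hφ)
    (hi hφ1.continuous hg.continuous (deriv_eq_zero_of_notMem_Icc hφ))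
    (hi hφs.continuous hg.continuous hφ), neg_neg]

theorem integral_deriv_deriv_mul {g : ℝ → ℂ} (hφs : ContDiff ℝ ∞ φ)
    (hφ : ∀ x ∉ Icc (-r) r, φ x = 0) (hg : ContDiff ℝ ∞ g) :
    ∫ x, deriv (deriv φ) x * g x = ∫ x, φ x * deriv (deriv g) x := by
  rw [integral_deriv_mul_eq_neg (contDiff_infty_iff_deriv.1 hφs).2
    (deriv_eq_zero_of_notMem_Icc hφ) hg,
    integral_deriv_mul_eq_neg hφs hφ (contDiff_infty_iff_deriv.1 hg).2, neg_neg]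

/-- Both sides have the same moments: pairing with `x^n` moves first `K` and then `L` onto the
monomial, which the composition fixes. -/
theorem volterraTranspose_comp {q : ℝ → ℂ} (hra : r ≤ a) (hq : ContDiff ℝ ∞ q)
    (hK : IsTransmutationKernel q 0 K) (hL : IsTransmutationKernel 0 q L)
    (hφs : ContDiff ℝ ∞ φ) (hφ : ∀ x ∉ Icc (-r) r, φ x = 0) :
    volterraTranspose a K (volterraTranspose a L φ) = φ := by
  have hKc := hK.contDiff.continuous
  have hLc := hL.contDiff.continuous
  have s1 := contDiff_volterraTranspose (a := a) hL.contDiff hφs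
  have z1 : ∀ x ∉ Icc (-r) r, volterraTranspose a L φ x = 0 := fun x hx ↦
    volterraTranspose_eq_zero hra hLc hφs.continuous hφ hx
  have s2 := contDiff_volterraTranspose (a := a) hK.contDiff s1
  have z2 : ∀ x ∉ Icc (-r) r, volterraTranspose a K (volterraTranspose a L φ) x = 0 := fun x hx ↦
    volterraTranspose_eq_zero hra hKc s1.continuous z1 hx
  have hi {u : ℝ → ℂ} (hu : Continuous u) (h0 : ∀ x ∉ Icc (-r) r, u x = 0) (n : ℕ) :
      Integrable fun x ↦ u x * (x : ℂ) ^ n :=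
    integrable_of_continuous_of_eq_zero (r := r) (hu.mul (contDiff_ofReal_pow n).continuous)
      fun x hx ↦ by simp [h0 x hx]
  have := eq_zero_of_forall_integral_mul_pow_eq_zero (r := r)
    (φ := fun x ↦ volterraTranspose a K (volterraTranspose a L φ) x - φ x)
    (s2.continuous.sub hφs.continuous) (fun x hx ↦ by rw [z2 x hx, hφ x hx, sub_zero]) fun n ↦ ?_
  · ext x
    exact sub_eq_zero.1 (congrFun this x)
  · have hp := contDiff_ofReal_pow n
    simp only [sub_mul]
    rw [integral_sub (hi s2.continuous z2 n) (hi hφs.continuous hφ n),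
      ← integral_mul_volterra hra hKc s1.continuous z1 hp.continuous.integrableOn_Icc,
      ← integral_mul_volterra hra hLc hφs.continuous hφ
        (contDiff_volterra hK.contDiff hp).continuous.integrableOn_Icc]
    simp only [volterra_volterra_pow hq hK hL, sub_self]

/-- The transposed operator of `K` sends the difference of the two sides to zero by the other
composition, and it is injective. -/
theorem volterraTranspose_comp' {q : ℝ → ℂ} (hra : r ≤ a) (hq : ContDiff ℝ ∞ q)
    (hK : IsTransmutationKernel q 0 K) (hL : IsTransmutationKernel 0 q L)
    (hφs : ContDiff ℝ ∞ φ) (hφ : ∀ x ∉ Icc (-r) r, φ x = 0) :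
    volterraTranspose a L (volterraTranspose a K φ) = φ := by
  have hKc := hK.contDiff.continuous
  have hLc := hL.contDiff.continuous
  have s1 := contDiff_volterraTranspose (a := a) hK.contDiff hφs
  have z1 : ∀ x ∉ Icc (-r) r, volterraTranspose a K φ x = 0 := fun x hx ↦
    volterraTranspose_eq_zero hra hKc hφs.continuous hφ hx
  have s2 := contDiff_volterraTranspose (a := a) hL.contDiff s1
  have z2 : ∀ x ∉ Icc (-r) r, volterraTranspose a L (volterraTranspose a K φ) x = 0 := fun x hx ↦
    volterraTranspose_eq_zero hra hLc s1.continuous z1 hx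
  have := eq_zero_of_volterraTranspose_eq_zero hra hKc (s2.continuous.sub hφs.continuous)
    (fun x hx ↦ by rw [Pi.sub_apply, z2 x hx, hφ x hx, sub_zero]) fun x ↦ by
      rw [volterraTranspose_sub hKc s2.continuous hφs.continuous,
        volterraTranspose_comp hra hq hK hL s1 z1, sub_self]
  ext x
  exact sub_eq_zero.1 (congrFun this x)

/-- Compared by moments: two integrations by parts on each side reduce the claim to the intertwining
relation for the Volterra operator on `x^n`. -/
theorem deriv_deriv_volterraTranspose {q : ℝ → ℂ} (hra : r ≤ a) (hq : ContDiff ℝ ∞ q)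
    (hK : IsTransmutationKernel q 0 K) (hφs : ContDiff ℝ ∞ φ) (hφ : ∀ x ∉ Icc (-r) r, φ x = 0) :
    deriv (deriv (volterraTranspose a K φ)) =
      volterraTranspose a K fun x ↦ deriv (deriv φ) x - q x * φ x := by
  have hKc := hK.contDiff.continuous
  have hφ2 : ContDiff ℝ ∞ (deriv (deriv φ)) :=
    (contDiff_infty_iff_deriv.1 (contDiff_infty_iff_deriv.1 hφs).2).2
  have hφ20 := deriv_eq_zero_of_notMem_Icc (deriv_eq_zero_of_notMem_Icc hφ)
  set ψ : ℝ → ℂ := fun x ↦ deriv (deriv φ) x - q x * φ x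
  have hψs : ContDiff ℝ ∞ ψ := hφ2.sub (hq.mul hφs)
  have hψ : ∀ x ∉ Icc (-r) r, ψ x = 0 := fun x hx ↦ by simp [ψ, hφ20 x hx, hφ x hx]
  have s1 := contDiff_volterraTranspose (a := a) hK.contDiff hφs
  have z1 : ∀ x ∉ Icc (-r) r, volterraTranspose a K φ x = 0 := fun x hx ↦
    volterraTranspose_eq_zero hra hKc hφs.continuous hφ hx
  have s1' : ContDiff ℝ ∞ (deriv (deriv (volterraTranspose a K φ))) :=
    (contDiff_infty_iff_deriv.1 (contDiff_infty_iff_deriv.1 s1).2).2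
  have z1' := deriv_eq_zero_of_notMem_Icc (deriv_eq_zero_of_notMem_Icc z1)
  have s2 := contDiff_volterraTranspose (a := a) hK.contDiff hψs
  have z2 : ∀ x ∉ Icc (-r) r, volterraTranspose a K ψ x = 0 := fun x hx ↦
    volterraTranspose_eq_zero hra hKc hψs.continuous hψ hx
  have hi {u g : ℝ → ℂ} (hu : Continuous u) (h0 : ∀ x ∉ Icc (-r) r, u x = 0)
      (hg : Continuous g) : Integrable fun x ↦ u x * g x :=
    integrable_of_continuous_of_eq_zero (r := r) (hu.mul hg) fun x hx ↦ by simp [h0 x hx]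
  have := eq_zero_of_forall_integral_mul_pow_eq_zero (r := r)
    (φ := fun x ↦ deriv (deriv (volterraTranspose a K φ)) x - volterraTranspose a K ψ x)
    (s1'.continuous.sub s2.continuous) (fun x hx ↦ by rw [z1' x hx, z2 x hx, sub_zero]) fun n ↦ ?_
  · ext x
    exact sub_eq_zero.1 (congrFun this x)
  · have hp := contDiff_ofReal_pow n
    have hp2 : ContDiff ℝ ∞ (deriv (deriv fun x : ℝ ↦ (x : ℂ) ^ n)) :=
      (contDiff_infty_iff_deriv.1 (contDiff_infty_iff_deriv.1 hp).2).2
    have hV := contDiff_volterra hK.contDiff hp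
    simp only [sub_mul]
    rw [integral_sub (hi s1'.continuous z1' hp.continuous) (hi s2.continuous z2 hp.continuous),
      integral_deriv_deriv_mul s1 z1 hp,
      ← integral_mul_volterra hra hKc hφs.continuous hφ hp2.continuous.integrableOn_Icc,
      ← integral_mul_volterra hra hKc hψs.continuous hψ hp.continuous.integrableOn_Icc]
    simp only [ψ, sub_mul]
    rw [integral_sub (hi hφ2.continuous hφ20 hV.continuous)
      (hi (hq.mul hφs).continuous (fun x hx ↦ by simp [hφ x hx]) hV.continuous),
      integral_deriv_deriv_mul hφs hφ hV, ← integral_sub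
      (hi hφs.continuous hφ (contDiff_infty_iff_deriv.1 (contDiff_infty_iff_deriv.1 hV).2).2.continuous)
      (hi (hq.mul hφs).continuous (fun x hx ↦ by simp [hφ x hx]) hV.continuous), sub_eq_zero]
    congr 1
    ext x
    rw [hK.deriv_deriv_volterra continuous_zero hp]
    simp only [Pi.zero_apply, zero_mul, sub_zero]
    ring

end

/-! ### The transposed operator on test functions -/

theorem exists_Icc_superset {a : ℝ} (ha : 0 < a) {K : Set ℝ} (hK : IsCompact K)
    (hKa : K ⊆ Ioo (-a) a) : ∃ r < a, K ⊆ Icc (-r) r := by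
  obtain rfl | hne := K.eq_empty_or_nonempty
  · exact ⟨0, ha, empty_subset _⟩
  · obtain ⟨x, hx, hmax⟩ := hK.exists_isMaxOn hne continuous_abs.continuousOn
    exact ⟨|x|, abs_lt.2 (hKa hx), fun y hy ↦ abs_le.1 (hmax hy)⟩

theorem TestFun.exists_support_radius {a : ℝ} (ha : 0 < a) (φ : TestFun a) :
    ∃ r < a, ∀ x ∉ Icc (-r) r, φ x = 0 := by
  obtain ⟨r, hr, h⟩ := exists_Icc_superset ha φ.hasCompactSupport φ.tsupport_subset
  exact ⟨r, hr, fun x hx ↦ image_eq_zero_of_notMem_tsupport fun h' ↦ hx (h h')⟩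

/-! ### Seminorm bounds for the transposed operator -/

section Bounds

variable {C : TopologicalSpace.Compacts ℝ}

/-- The `n`-th derivatives of the functions `A φ` are bounded on `S` by a continuous seminorm
of `φ`. -/
def HasDerivBound (S : Set ℝ) (A : 𝓓_{C}(ℝ, ℂ) → ℝ → ℂ) (n : ℕ) : Prop :=
  ∃ (s : Finset ℕ) (M : ℝ), 0 ≤ M ∧ ∀ φ, ∀ x ∈ S,
    ‖iteratedDeriv n (A φ) x‖ ≤ M * (s.sup fun j ↦ N[ℂ]_{C, j}) φ

theorem HasDerivBound.sub {S : Set ℝ} {A B : 𝓓_{C}(ℝ, ℂ) → ℝ → ℂ} {n : ℕ}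
    (hA : HasDerivBound S A n) (hB : HasDerivBound S B n)
    (hAs : ∀ φ, ContDiff ℝ ∞ (A φ)) (hBs : ∀ φ, ContDiff ℝ ∞ (B φ)) :
    HasDerivBound S (fun φ x ↦ A φ x - B φ x) n := by
  obtain ⟨s, M, hM, h⟩ := hA
  obtain ⟨s', M', hM', h'⟩ := hB
  refine ⟨s ∪ s', M + M', add_nonneg hM hM', fun φ x hx ↦ ?_⟩
  rw [iteratedDeriv_fun_sub (((hAs φ).of_le (by exact_mod_cast le_top)).contDiffAt)
    (((hBs φ).of_le (by exact_mod_cast le_top)).contDiffAt), add_mul]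
  have l1 : (s.sup fun j ↦ N[ℂ]_{C, j}) φ ≤ ((s ∪ s').sup fun j ↦ N[ℂ]_{C, j}) φ :=
    (Finset.sup_mono (f := fun j ↦ N[ℂ; ℂ]_{C, j}) Finset.subset_union_left) φ
  have l2 : (s'.sup fun j ↦ N[ℂ]_{C, j}) φ ≤ ((s ∪ s').sup fun j ↦ N[ℂ]_{C, j}) φ :=
    (Finset.sup_mono (f := fun j ↦ N[ℂ; ℂ]_{C, j}) Finset.subset_union_right) φ
  exact (norm_sub_le _ _).trans (add_le_add ((h φ x hx).trans (mul_le_mul_of_nonneg_left l1 hM))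
    ((h' φ x hx).trans (mul_le_mul_of_nonneg_left l2 hM')))

theorem hasDerivBound_mul (S : Set ℝ) {m : ℝ → ℂ} (hm : ContDiff ℝ ∞ m) (n : ℕ) :
    HasDerivBound S (fun (φ : 𝓓_{C}(ℝ, ℂ)) x ↦ φ x * m x) n := by
  let Φ : 𝓓_{C}(ℝ, ℂ) →L[ℂ] 𝓓_{C}(ℝ, ℂ) :=
    ContDiffMapSupportedIn.bilinLeftCLM (ContinuousLinearMap.mul ℂ ℂ) hm
  have hcont : Continuous ((N[ℂ; ℂ]_{C, n}).comp Φ.toLinearMap) :=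
    ((ContDiffMapSupportedIn.withSeminorms ℂ ℝ ℂ ⊤ C).continuous_seminorm n).comp Φ.continuous
  obtain ⟨s, M, -, h⟩ := Seminorm.bound_of_continuous
    (ContDiffMapSupportedIn.withSeminorms ℂ ℝ ℂ ⊤ C) _ hcont
  refine ⟨s, M, M.2, fun φ x _ ↦ ?_⟩
  rw [← norm_iteratedFDeriv_eq_norm_iteratedDeriv]
  exact (ContDiffMapSupportedIn.norm_iteratedFDeriv_apply_le_seminorm_top ℂ (f := Φ φ)).trans (h φ)

theorem hasDerivBound_mul_comp_neg (S : Set ℝ) {m : ℝ → ℂ} (hm : ContDiff ℝ ∞ m) (n : ℕ) :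
    HasDerivBound S (fun (φ : 𝓓_{C}(ℝ, ℂ)) x ↦ φ (-x) * m (-x)) n := by
  obtain ⟨s, M, hM, h⟩ := hasDerivBound_mul (C := C) univ hm n
  refine ⟨s, M, hM, fun φ x _ ↦ ?_⟩
  rw [iteratedDeriv_comp_neg n (fun x ↦ φ x * m x), norm_smul]
  simpa using h φ (-x) (mem_univ _)

theorem hasDerivBound_transposeIntegral {a r : ℝ} (hC : (C : Set ℝ) ⊆ Icc (-r) r) (n : ℕ) :
    ∀ {K : ℝ → ℝ → ℂ}, ContDiff ℝ ∞ ↿K →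
      HasDerivBound (Icc (-r) r) (fun (φ : 𝓓_{C}(ℝ, ℂ)) ↦ transposeIntegral a K φ) n := by
  induction n with
  | zero =>
    intro K hK
    obtain ⟨M, hM⟩ := ((isCompact_Icc (a := -r) (b := r)).prod
      (isCompact_Icc (a := -r) (b := r))).exists_bound_of_continuousOn hK.continuous.continuousOn
    -- The integrand has two terms, each at most `max M 0` times the sup seminorm, over an interval
    -- of length `|a - x|`. The maxima keep the constant nonnegative when `[-r, r]` is empty.
    refine ⟨{0}, 2 * max M 0 * (|a| + r ⊔ 0), by positivity, fun φ x hx ↦ ?_⟩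
    rw [iteratedDeriv_zero, Finset.sup_singleton]
    have hN : 0 ≤ N[ℂ]_{C, 0} φ := apply_nonneg _ _
    have b (t : ℝ) : ‖K t x * φ t‖ ≤ max M 0 * N[ℂ]_{C, 0} φ := by
      by_cases ht : t ∈ C
      · rw [norm_mul]
        exact mul_le_mul ((hM (t, x) ⟨hC ht, hx⟩).trans (le_max_left _ _))
          (ContDiffMapSupportedIn.norm_apply_le_seminorm ℂ) (norm_nonneg _) (le_max_right _ _)
      · rw [φ.zero_on_compl ht]
        simp only [Pi.zero_apply, mul_zero, norm_zero]
        positivity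
    refine (intervalIntegral.norm_integral_le_of_norm_le_const
      (C := 2 * (max M 0 * N[ℂ]_{C, 0} φ)) fun t _ ↦ ?_).trans ?_
    · exact (norm_sub_le _ _).trans ((add_le_add (b t) (b (-t))).trans_eq (by ring))
    · have : |a - x| ≤ |a| + r ⊔ 0 :=
        (abs_sub _ _).trans (add_le_add_right ((abs_le.2 hx).trans (le_max_left _ _)) _)
      refine (mul_le_mul_of_nonneg_left this (by positivity)).trans_eq (by ring)
  | succ n ih =>
    intro K hK
    have hK2 : ContDiff ℝ ∞ ↿(partialSnd K) := contDiff_partialSnd hK (by simp)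
    have m1 : ContDiff ℝ ∞ fun x ↦ K x x := hK.comp (contDiff_id.prodMk contDiff_id)
    have m2 : ContDiff ℝ ∞ fun x ↦ K x (-x) := hK.comp (contDiff_id.prodMk contDiff_neg)
    have b2 := hasDerivBound_mul_comp_neg (C := C) (Icc (-r) r) m2 n
    simp only [neg_neg] at b2
    have s1 (φ : 𝓓_{C}(ℝ, ℂ)) : ContDiff ℝ ∞ fun x ↦ φ x * K x x := φ.contDiff.mul m1
    have s2 (φ : 𝓓_{C}(ℝ, ℂ)) : ContDiff ℝ ∞ fun x ↦ φ (-x) * K (-x) x := by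
      have := (φ.contDiff.mul m2).comp contDiff_neg
      simpa [Function.comp_def] using this
    obtain ⟨s, M, hM, h⟩ := (ih hK2).sub ((hasDerivBound_mul (Icc (-r) r) m1 n).sub b2 s1 s2)
      (fun φ ↦ contDiff_transposeIntegral hK2 φ.contDiff) (fun φ ↦ (s1 φ).sub (s2 φ))
    refine ⟨s, M, hM, fun φ x hx ↦ ?_⟩
    rw [iteratedDeriv_succ', deriv_transposeIntegral hK φ.contDiff]
    exact h φ x hx

end Bounds

/-- A kernel that agrees on every compact square in `I × I` with a smooth function on the plane. -/
def IsSmoothKernelOn (a : ℝ) (k : ℝ → ℝ → ℂ) : Prop :=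
  ∀ r < a, ∃ K : ℝ → ℝ → ℂ, ContDiff ℝ ∞ ↿K ∧
    ∀ x ∈ Icc (-r) r, ∀ t ∈ Icc (-r) r, k x t = K x t

section

variable {a : ℝ} {k : ℝ → ℝ → ℂ}

theorem IsSmoothKernelOn.contDiff_and_eq_zero (hk : IsSmoothKernelOn a k) {r : ℝ} (hr : r < a)
    {φ : ℝ → ℂ} (hφs : ContDiff ℝ ∞ φ) (hφ : ∀ x ∉ Icc (-r) r, φ x = 0) :
    ContDiff ℝ ∞ (volterraTranspose a k φ) ∧
      ∀ x ∉ Icc (-r) r, volterraTranspose a k φ x = 0 := by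
  obtain ⟨K, hK, hkK⟩ := hk r hr
  rw [show volterraTranspose a k φ = volterraTranspose a K φ from
    funext (volterraTranspose_congr hr hφ hkK)]
  exact ⟨contDiff_volterraTranspose hK hφs,
    fun x hx ↦ volterraTranspose_eq_zero hr.le hK.continuous hφs.continuous hφ hx⟩

/-- The compact interval `[-r, r]`. -/
def symCompact (r : ℝ) : TopologicalSpace.Compacts ℝ := ⟨Icc (-r) r, isCompact_Icc⟩

/-- The transposed operator between spaces of smooth functions with fixed compact support. -/
noncomputable def transposeSupportedInCLM (hk : IsSmoothKernelOn a k)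
    {C : TopologicalSpace.Compacts ℝ} {r : ℝ} (hr : r < a) (hC : (C : Set ℝ) ⊆ Icc (-r) r) :
    𝓓_{C}(ℝ, ℂ) →L[ℂ] 𝓓_{symCompact r}(ℝ, ℂ) :=
  have h0 (φ : 𝓓_{C}(ℝ, ℂ)) : ∀ x ∉ Icc (-r) r, φ x = 0 := fun x hx ↦
    φ.zero_on_compl fun h ↦ hx (hC h)
  have eq {K : ℝ → ℝ → ℂ} (hK : ContDiff ℝ ∞ ↿K)
      (hkK : ∀ x ∈ Icc (-r) r, ∀ t ∈ Icc (-r) r, k x t = K x t) (φ : 𝓓_{C}(ℝ, ℂ)) (x : ℝ) :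
      volterraTranspose a k φ x = φ x + transposeIntegral a K φ x :=
    (volterraTranspose_congr hr (h0 φ) hkK x).trans
      (volterraTranspose_eq_add hK.continuous φ.continuous x)
  ContDiffMapSupportedIn.mkCLM ℂ (fun φ ↦ volterraTranspose a k φ)
    (fun φ ψ x ↦ by
      obtain ⟨K, hK, hkK⟩ := hk r hr
      have := volterraTranspose_sub (a := a) hK.continuous (φ + ψ).continuous ψ.continuous x
      have e : (⇑(φ + ψ) - ⇑ψ) = φ := by
        ext y
        simp
      rw [e] at this
      rw [volterraTranspose_congr hr (h0 _) hkK, volterraTranspose_congr hr (h0 _) hkK,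
        volterraTranspose_congr hr (h0 _) hkK, this]
      ring)
    (fun c φ x ↦ by
      have e : ⇑(c • φ) = fun y ↦ c * φ y := rfl
      simp only [e, volterraTranspose, mul_left_comm _ c, intervalIntegral.integral_const_mul,
        smul_eq_mul]
      ring)
    (fun φ ↦ (hk.contDiff_and_eq_zero hr φ.contDiff (h0 φ)).1)
    (fun φ ↦ (hk.contDiff_and_eq_zero hr φ.contDiff (h0 φ)).2)
    (fun n _ ↦ by
      obtain ⟨K, hK, hkK⟩ := hk r hr
      -- The sum is treated as a difference with kernel `-K`, so that `HasDerivBound.sub` applies.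
      have hneg : ContDiff ℝ ∞ ↿(fun x t ↦ -K x t) := hK.neg
      have b := (hasDerivBound_mul (C := C) (Icc (-r) r) (contDiff_const (c := (1 : ℂ))) n).sub
        (hasDerivBound_transposeIntegral (a := a) hC n hneg)
        (fun φ ↦ φ.contDiff.mul contDiff_const)
        (fun φ ↦ contDiff_transposeIntegral hneg φ.contDiff)
      obtain ⟨s, M, hM, h⟩ := b
      refine ⟨s, M, hM, fun φ x hx ↦ ?_⟩
      rw [norm_iteratedFDeriv_eq_norm_iteratedDeriv]
      refine le_of_eq_of_le ?_ (h φ x hx)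
      congr 2
      ext y
      rw [eq hK hkK]
      simp only [transposeIntegral, mul_one]
      rw [sub_eq_add_neg, ← intervalIntegral.integral_neg]
      congr 2
      ext t
      ring)

/-- The transposed operator as a continuous linear operator on test functions. -/
noncomputable def transposeCLM (ha : 0 < a) (hk : IsSmoothKernelOn a k) :
    TestFun a →L[ℂ] TestFun a :=
  have hr (φ : TestFun a) : ∃ r < a, ContDiff ℝ ∞ (volterraTranspose a k φ) ∧
      ∀ x ∉ Icc (-r) r, volterraTranspose a k φ x = 0 := by
    obtain ⟨r, hr, h0⟩ := φ.exists_support_radius ha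
    exact ⟨r, hr, hk.contDiff_and_eq_zero hr φ.contDiff h0⟩
  have sub {r : ℝ} (h : r < a) : Icc (-r) r ⊆ Ioo (-a) a := fun x hx ↦
    ⟨by linarith [hx.1], by linarith [hx.2]⟩
  TestFunction.limitCLM ℂ
    (fun φ ↦ ⟨volterraTranspose a k φ, (hr φ).choose_spec.2.1,
      HasCompactSupport.intro isCompact_Icc (hr φ).choose_spec.2.2,
      (closure_minimal (Function.support_subset_iff'.2 (hr φ).choose_spec.2.2) isClosed_Icc).trans
        (sub (hr φ).choose_spec.1)⟩)
    (fun C hC ↦ (TestFunction.ofSupportedInCLM ℂ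
        (K := symCompact (exists_Icc_superset ha C.isCompact hC).choose)
        (sub (exists_Icc_superset ha C.isCompact hC).choose_spec.1)).comp
      (transposeSupportedInCLM hk (exists_Icc_superset ha C.isCompact hC).choose_spec.1
        (exists_Icc_superset ha C.isCompact hC).choose_spec.2))
    (fun _ _ _ ↦ rfl)

theorem transposeCLM_apply (ha : 0 < a) (hk : IsSmoothKernelOn a k) (φ : TestFun a) :
    ⇑(transposeCLM ha hk φ) = volterraTranspose a k φ := rfl

end

/-! ### The kernels of the transmutation operator and of its inverse -/

/-- The coefficient `c q(α + c β)`; for `c = 1` it belongs to the kernel of the transmutation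
operator, for `c = -1` to that of its inverse. -/
noncomputable def goursatCoeff (c : ℝ) (q : ℝ → ℂ) (α β : ℝ) : ℂ := c * q (α + c * β)

theorem contDiff_goursatCoeff (c : ℝ) {q : ℝ → ℂ} (hq : ContDiff ℝ ∞ q) :
    ContDiff ℝ ∞ ↿(goursatCoeff c q) :=
  contDiff_const.mul (hq.comp (contDiff_fst.add (contDiff_const.mul contDiff_snd)))

theorem abs_le_of_mem_uIcc_zero {x u : ℝ} (h : x ∈ uIcc 0 u) : |x| ≤ |u| := by
  simpa using abs_sub_left_of_mem_uIcc h

theorem abs_add_mul_le {c α β : ℝ} (hc : |c| = 1) : |α + c * β| ≤ |α| + |β| := by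
  simpa [abs_mul, hc] using abs_add_le α (c * β)

theorem goursatCoeff_congr {c ρ : ℝ} (hc : |c| = 1) {p q : ℝ → ℂ}
    (h : ∀ x ∈ Icc (-ρ) ρ, p x = q x) {α β : ℝ} (hαβ : |α| + |β| ≤ ρ) :
    goursatCoeff c p α β = goursatCoeff c q α β := by
  rw [goursatCoeff, goursatCoeff, h _ (abs_le.1 ((abs_add_mul_le hc).trans hαβ))]

theorem integral_congr_of_abs_le {ρ : ℝ} {p q : ℝ → ℂ} (h : ∀ x ∈ Icc (-ρ) ρ, p x = q x) {u : ℝ}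
    (hu : |u| ≤ ρ) : ∫ s in (0 : ℝ)..u, p s = ∫ s in (0 : ℝ)..u, q s :=
  intervalIntegral.integral_congr fun s hs ↦
    h s (abs_le.1 ((abs_le_of_mem_uIcc_zero hs).trans hu))

theorem abs_add_abs_le_of_mem_uIcc {u v α β : ℝ} (hα : α ∈ uIcc 0 u) (hβ : β ∈ uIcc 0 v) :
    |α| + |β| ≤ |u| + |v| :=
  add_le_add (abs_le_of_mem_uIcc_zero hα) (abs_le_of_mem_uIcc_zero hβ)

/-- For `c = 1` the argument `u + v` is `x` and the potentials are `p` and `0`; for `c = -1` the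
argument `u - v` is `t` and they are `0` and `p`. -/
theorem isTransmutationKernel_of_goursatCoeff {c : ℝ} (hc : c = 1 ∨ c = -1) {p : ℝ → ℂ}
    (hp : ContDiff ℝ ∞ p) {G : ℝ → ℝ → ℂ} (hG : Continuous ↿G)
    (h : ∀ u v, G u v = c / 2 * (∫ s in (0 : ℝ)..u, p s) + goursatOp (goursatCoeff c p) G u v) :
    IsTransmutationKernel (fun x ↦ (1 + c) / 2 * p x) (fun x ↦ (1 - c) / 2 * p x)
      fun x t ↦ G ((x + t) / 2) ((x - t) / 2) := by
  refine isTransmutationKernel_of_goursat (contDiff_goursatCoeff c hp) hG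
    ((contDiff_const.mul hp).sub (contDiff_const.mul hp)) (fun x t ↦ ?_)
    (g := fun u ↦ c / 2 * ∫ s in (0 : ℝ)..u, p s) (by simp) (fun u ↦ ?_) h
  · obtain rfl | rfl := hc
    · have : (x + t) / 2 + 1 * ((x - t) / 2) = x := by ring
      rw [goursatCoeff, this]
      push_cast
      ring
    · have : (x + t) / 2 + -1 * ((x - t) / 2) = t := by ring
      rw [goursatCoeff, this]
      push_cast
      ring
  · refine ((hp.continuous.integral_hasStrictDerivAt 0 u).hasDerivAt.const_mul _).congr_deriv ?_
    ring

/-- The left side is the maximum of `|x|` and `|t|`. -/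
theorem abs_half_add_abs_half_le {r x t : ℝ} (hx : x ∈ Icc (-r) r) (ht : t ∈ Icc (-r) r) :
    |(x + t) / 2| + |(x - t) / 2| ≤ r := by
  obtain h1 | h1 := abs_cases ((x + t) / 2) <;> obtain h2 | h2 := abs_cases ((x - t) / 2) <;>
    linarith [hx.1, hx.2, ht.1, ht.2]

/-- The Goursat problem on the square, together with smooth extensions of the kernel. -/
theorem exists_goursat_kernel {a : ℝ} {q : ℝ → ℂ} (hq : ContDiffOn ℝ ∞ q (Ioo (-a) a)) {c : ℝ}
    (hc : c = 1 ∨ c = -1) :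
    ∃ H : ℝ × ℝ → ℂ, ContinuousOn H (charSquare a) ∧
      (∀ u v, (u, v) ∈ charSquare a → H (u, v) = c / 2 * (∫ s in (0 : ℝ)..u, q s) +
        goursatOp (goursatCoeff c q) (fun α β ↦ H (α, β)) u v) ∧
      ∀ r < a, ∀ p : ℝ → ℂ, ContDiff ℝ ∞ p → (∀ x ∈ Icc (-r) r, p x = q x) →
        ∃ K, IsTransmutationKernel (fun x ↦ (1 + c) / 2 * p x) (fun x ↦ (1 - c) / 2 * p x) K ∧
          ∀ x ∈ Icc (-r) r, ∀ t ∈ Icc (-r) r, kernel H x t = K x t := by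
  have hc1 : |c| = 1 := by obtain rfl | rfl := hc <;> simp
  have hsol (p : ℝ → ℂ) (hp : ContDiff ℝ ∞ p) : ∃ G : ℝ → ℝ → ℂ, Continuous ↿G ∧ ∀ u v,
      G u v = c / 2 * (∫ s in (0 : ℝ)..u, p s) + goursatOp (goursatCoeff c p) G u v :=
    exists_continuous_goursat (g := fun u ↦ c / 2 * ∫ s in (0 : ℝ)..u, p s)
      (contDiff_goursatCoeff c hp).continuous (continuous_const.mul
      (intervalIntegral.continuous_primitive (fun _ _ ↦ hp.continuous.intervalIntegrable _ _) 0))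
  choose G hGc hG using hsol
  -- Finite dependence: the solution at `(u, v)` sees the potential only at points of absolute value
  -- at most `|u| + |v|`.
  have agree {p p' : ℝ → ℂ} (hp : ContDiff ℝ ∞ p) (hp' : ContDiff ℝ ∞ p') {u v : ℝ}
      (h : ∀ x ∈ Icc (-(|u| + |v|)) (|u| + |v|), p x = p' x) : G p hp u v = G p' hp' u v :=
    goursat_unique (contDiff_goursatCoeff c hp).continuous.continuousOn (hGc p hp).continuousOn
      (hGc p' hp').continuousOn
      (fun α hα β hβ ↦ goursatCoeff_congr hc1 h (abs_add_abs_le_of_mem_uIcc hα hβ))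
      (g := fun u ↦ c / 2 * ∫ s in (0 : ℝ)..u, p s) (g' := fun u ↦ c / 2 * ∫ s in (0 : ℝ)..u, p' s)
      (fun α hα ↦ congrArg _ (integral_congr_of_abs_le h
        ((abs_le_of_mem_uIcc_zero hα).trans (le_add_of_nonneg_right (abs_nonneg v)))))
      (fun α _ β _ ↦ hG p hp α β) (fun α _ β _ ↦ hG p' hp' α β)
  have hext (r : ℝ) (hr : r < a) : ∃ p : ℝ → ℂ, ContDiff ℝ ∞ p ∧ ∀ x ∈ Icc (-r) r, p x = q x :=
    exists_smooth_eq_on_compact hq (symCompact r) fun x hx ↦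
      ⟨by linarith [hx.1], by linarith [hx.2]⟩
  choose P hPs hP using hext
  -- Each point uses an extension of `q` adapted to its own radius; by `agree` the value does not
  -- depend on the extension.
  let H : ℝ × ℝ → ℂ := fun z ↦
    if h : |z.1| + |z.2| < a then G (P _ h) (hPs _ h) z.1 z.2 else 0
  have hH {r : ℝ} (hr : r < a) {p : ℝ → ℂ} (hp : ContDiff ℝ ∞ p)
      (hpq : ∀ x ∈ Icc (-r) r, p x = q x) (u v : ℝ) (huv : |u| + |v| ≤ r) :
      H (u, v) = G p hp u v := by
    have h : |u| + |v| < a := huv.trans_lt hr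
    simp only [H, dif_pos h]
    refine agree _ _ fun x hx ↦ ?_
    rw [hP _ h x hx, hpq x ⟨by linarith [hx.1], by linarith [hx.2]⟩]
  refine ⟨H, fun z hz ↦ ContinuousAt.continuousWithinAt ?_, fun u v huv ↦ ?_,
    fun r hr p hp hpq ↦ ⟨_, isTransmutationKernel_of_goursatCoeff hc hp (hGc p hp) (hG p hp),
      fun x hx t ht ↦ hH hr hp hpq _ _ (abs_half_add_abs_half_le hx ht)⟩⟩
  · have hz' : |z.1| + |z.2| < a := hz
    -- A radius strictly between that of `z` and `a`, so that one global solution represents `H`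
    -- near `z`.
    set r := (|z.1| + |z.2| + a) / 2 with hr
    have hra : r < a := by linarith
    have hopen : IsOpen {w : ℝ × ℝ | |w.1| + |w.2| < r} := isOpen_lt (by fun_prop) continuous_const
    refine (hGc _ (hPs r hra)).continuousAt.congr ?_
    filter_upwards [hopen.mem_nhds (show |z.1| + |z.2| < r by linarith)] with w hw
    exact (hH hra (hPs r hra) (hP r hra) w.1 w.2 (le_of_lt hw)).symm
  · have huv' : |u| + |v| < a := huv
    have h := hP _ huv'
    rw [hH huv' (hPs _ huv') h u v le_rfl, hG,
      integral_congr_of_abs_le h (le_add_of_nonneg_right (abs_nonneg v))]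
    congr 1
    exact goursatOp_congr
      (fun α hα β hβ ↦ goursatCoeff_congr hc1 h (abs_add_abs_le_of_mem_uIcc hα hβ))
      (fun α hα β hβ ↦ (hH huv' (hPs _ huv') h α β (abs_add_abs_le_of_mem_uIcc hα hβ)).symm)

theorem IsKernelSolution.eqOn {a : ℝ} {q : ℝ → ℂ} (hq : ContinuousOn q (Ioo (-a) a))
    {H H' : ℝ × ℝ → ℂ} (hH : IsKernelSolution a q H) (hH' : IsKernelSolution a q H') :
    EqOn H H' (charSquare a) := by
  rintro ⟨u, v⟩ huv
  have hbox : uIcc 0 u ×ˢ uIcc 0 v ⊆ charSquare a := fun z hz ↦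
    (abs_add_abs_le_of_mem_uIcc hz.1 hz.2).trans_lt huv
  refine goursat_unique (Q := fun α β ↦ q (α + β)) (Q' := fun α β ↦ q (α + β))
    (H := fun α β ↦ H (α, β)) (H' := fun α β ↦ H' (α, β))
    (g := fun u ↦ 1 / 2 * ∫ s in (0 : ℝ)..u, q s) (g' := fun u ↦ 1 / 2 * ∫ s in (0 : ℝ)..u, q s)
    ?_ (hH.continuousOn.mono hbox) (hH'.continuousOn.mono hbox) (fun _ _ _ _ ↦ rfl)
    (fun _ _ ↦ rfl) (fun α hα β hβ ↦ hH.integral_eq α β (hbox ⟨hα, hβ⟩))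
    (fun α hα β hβ ↦ hH'.integral_eq α β (hbox ⟨hα, hβ⟩))
  refine hq.comp (f := fun z : ℝ × ℝ ↦ z.1 + z.2) (by fun_prop) fun z hz ↦ ?_
  exact abs_lt.1 ((abs_add_le _ _).trans_lt (hbox hz))

/-! ### Operators on distributions -/

section

variable {a r : ℝ} {k K l L : ℝ → ℝ → ℂ}

theorem volterraTranspose_comp_of_eq {φ : ℝ → ℂ} (hr : r < a) (hl : IsSmoothKernelOn a l)
    (hφs : ContDiff ℝ ∞ φ) (hφ : ∀ x ∉ Icc (-r) r, φ x = 0)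
    (hkK : ∀ x ∈ Icc (-r) r, ∀ t ∈ Icc (-r) r, k x t = K x t)
    (hlL : ∀ x ∈ Icc (-r) r, ∀ t ∈ Icc (-r) r, l x t = L x t) :
    volterraTranspose a k (volterraTranspose a l φ) =
      volterraTranspose a K (volterraTranspose a L φ) := by
  rw [← show volterraTranspose a l φ = volterraTranspose a L φ from
    funext (volterraTranspose_congr hr hφ hlL)]
  exact funext (volterraTranspose_congr hr (hl.contDiff_and_eq_zero hr hφs hφ).2 hkK)

theorem volterra_eqOn (hkK : ∀ x ∈ Icc (-r) r, ∀ t ∈ Icc (-r) r, k x t = K x t) (f : ℝ → ℂ) :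
    EqOn (volterra k f) (volterra K f) (Icc (-r) r) := by
  intro x hx
  unfold volterra
  congr 1
  refine intervalIntegral.integral_congr fun t ht ↦ ?_
  have hnx : -x ∈ Icc (-r) r := ⟨by linarith [hx.2], by linarith [hx.1]⟩
  have : t ∈ Icc (-r) r := uIcc_subset_Icc hnx hx ht
  simp only [hkK x hx t this]

theorem IsSmoothKernelOn.locallyIntegrableOn_volterra (ha : 0 < a) (hk : IsSmoothKernelOn a k)
    {f : ℝ → ℂ} (hf : LocallyIntegrableOn f (Ioo (-a) a)) :
    LocallyIntegrableOn (volterra k f) (Ioo (-a) a) := by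
  rw [locallyIntegrableOn_iff isOpen_Ioo.isLocallyClosed] at hf ⊢
  intro C hC hCc
  obtain ⟨r, hr, hCr⟩ := exists_Icc_superset ha hCc hC
  obtain ⟨K, hK, hkK⟩ := hk r hr
  refine IntegrableOn.mono_set ?_ hCr
  refine IntegrableOn.congr_fun (integrableOn_volterra hK.continuous (hf _ ?_ isCompact_Icc))
    (volterra_eqOn hkK f).symm measurableSet_Icc
  exact fun x hx ↦ ⟨by linarith [hx.1], by linarith [hx.2]⟩

theorem regularDistr_apply {f : ℝ → ℂ} (hf : LocallyIntegrableOn f (Ioo (-a) a))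
    (φ : TestFun a) : regularDistr a f φ = ∫ x, φ x * f x :=
  TestFunction.integralAgainstBilinCLM_eq_integral (B := ContinuousLinearMap.mul ℂ ℂ) hf

theorem regularDistr_transposeCLM (ha : 0 < a) (hk : IsSmoothKernelOn a k) {f : ℝ → ℂ}
    (hf : LocallyIntegrableOn f (Ioo (-a) a)) (φ : TestFun a) :
    regularDistr a f (transposeCLM ha hk φ) = regularDistr a (volterra k f) φ := by
  rw [regularDistr_apply hf, regularDistr_apply (hk.locallyIntegrableOn_volterra ha hf),
    transposeCLM_apply]
  obtain ⟨r, hr, h0⟩ := φ.exists_support_radius ha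
  obtain ⟨K, hK, hkK⟩ := hk r hr
  have hfr : IntegrableOn f (Icc (-r) r) :=
    hf.integrableOn_compact_subset (fun x hx ↦ ⟨by linarith [hx.1], by linarith [hx.2]⟩)
      isCompact_Icc
  rw [show volterraTranspose a k φ = volterraTranspose a K φ from
    funext (volterraTranspose_congr hr h0 hkK),
    ← integral_mul_volterra hr.le hK.continuous φ.continuous h0 hfr]
  congr 1
  ext x
  by_cases hx : x ∈ Icc (-r) r
  · rw [volterra_eqOn hkK f hx]
  · rw [h0 x hx, zero_mul, zero_mul]

end

theorem coe_lineDerivCLM_one {a : ℝ} (φ : TestFun a) :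
    ⇑(TestFunction.lineDerivCLM ℂ (1 : ℝ) φ : TestFun a) = deriv φ := by
  ext x
  rw [TestFunction.lineDerivCLM_eq_fderivCLM, TestFunction.fderivCLM_apply_of_le _ le_top]
  exact fderiv_apply_one_eq_deriv

theorem distrDeriv_distrDeriv_apply {a : ℝ} (u : Distr a) (φ : TestFun a) :
    distrDeriv a (distrDeriv a u) φ = u (TestFunction.lineDerivCLM ℂ (1 : ℝ)
      (TestFunction.lineDerivCLM ℂ (1 : ℝ) φ : TestFun a)) := by
  change -(-u _) = u _
  exact neg_neg _

/-- An operator on distributions that is the transpose of an operator on test functions. -/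
noncomputable def distrEquivOfTranspose {a : ℝ} (A B : TestFun a →L[ℂ] TestFun a)
    (hAB : ∀ φ, A (B φ) = φ) (hBA : ∀ φ, B (A φ) = φ) : Distr a ≃L[ℂ] Distr a :=
  ContinuousLinearEquiv.equivOfInverse (PointwiseConvergenceCLM.precomp ℂ A)
    (PointwiseConvergenceCLM.precomp ℂ B)
    (fun u ↦ ContinuousLinearMap.ext fun φ ↦ congrArg u (hAB φ))
    (fun u ↦ ContinuousLinearMap.ext fun φ ↦ congrArg u (hBA φ))

end Transmutation

theorem mainTheorem8 (a : ℝ) (ha : 0 < a) (q : ℝ → ℂ) (hq : ContDiffOn ℝ ∞ q (Ioo (-a) a)) :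
    -- the kernel is well defined: the integral equation has exactly one continuous solution `H`
    ∃ H : ℝ × ℝ → ℂ, Transmutation.IsKernelSolution a q H ∧
      (∀ H' : ℝ × ℝ → ℂ, Transmutation.IsKernelSolution a q H' →
        EqOn H' H (Transmutation.charSquare a)) ∧
      -- the transposed operator is a continuous linear operator on test functions
      ∃ Tt : Transmutation.TestFun a →L[ℂ] Transmutation.TestFun a,
        (∀ φ : Transmutation.TestFun a, ∀ x ∈ Ioo (-a) a,
          Tt φ x = Transmutation.volterraTranspose a (Transmutation.kernel H) φ x) ∧
        -- the operator `T` defined by transposition is continuous and invertible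
        ∃ T : Transmutation.Distr a ≃L[ℂ] Transmutation.Distr a,
          (∀ (u : Transmutation.Distr a) (φ : Transmutation.TestFun a), T u φ = u (Tt φ)) ∧
          -- it extends the Volterra operator from functions to distributions
          (∀ f : ℝ → ℂ, LocallyIntegrableOn f (Ioo (-a) a) →
            LocallyIntegrableOn (Transmutation.volterra (Transmutation.kernel H) f)
              (Ioo (-a) a) ∧
            T (Transmutation.regularDistr a f) =
              Transmutation.regularDistr a
                (Transmutation.volterra (Transmutation.kernel H) f)) ∧
          -- it is a transmutation operator on all of `𝓓'(I)`
          Transmutation.IsTransmutationOn hq (T : Transmutation.Distr a →ₗ[ℂ] Transmutation.Distr a)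
            univ := by
  open Transmutation in
  obtain ⟨H, hHc, hHe, hHk⟩ := exists_goursat_kernel hq (c := 1) (.inl rfl)
  obtain ⟨H', -, -, hHk'⟩ := exists_goursat_kernel hq (c := -1) (.inr rfl)
  -- Evaluating `(1 ± c) / 2` leaves the potentials `p, 0` for `H` and `0, p` for `H'`, as the
  -- composition lemmas require.
  simp only [Complex.ofReal_neg, Complex.ofReal_one, add_neg_cancel, sub_neg_eq_add, sub_self,
    zero_div, zero_mul, one_add_one_eq_two, div_self (two_ne_zero' ℂ), one_mul] at hHk hHk'
  have hsol : IsKernelSolution a q H := by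
    refine ⟨hHc, fun u v huv ↦ ?_⟩
    rw [hHe u v huv]
    simp [goursatOp, goursatCoeff]
  have hext (r : ℝ) (hr : r < a) : ∃ p : ℝ → ℂ, ContDiff ℝ ∞ p ∧ ∀ x ∈ Icc (-r) r, p x = q x :=
    exists_smooth_eq_on_compact hq (symCompact r) fun x hx ↦
      ⟨by linarith [hx.1], by linarith [hx.2]⟩
  have hk : IsSmoothKernelOn a (kernel H) := fun r hr ↦ by
    obtain ⟨p, hp, hpq⟩ := hext r hr
    obtain ⟨K, hK, h⟩ := hHk r hr p hp hpq
    exact ⟨K, hK.contDiff, h⟩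
  have hk' : IsSmoothKernelOn a (kernel H') := fun r hr ↦ by
    obtain ⟨p, hp, hpq⟩ := hext r hr
    obtain ⟨K, hK, h⟩ := hHk' r hr p hp hpq
    exact ⟨K, hK.contDiff, h⟩
  refine ⟨H, hsol, fun H₁ h₁ ↦ h₁.eqOn hq.continuousOn hsol, transposeCLM ha hk,
    fun φ x _ ↦ rfl, distrEquivOfTranspose (transposeCLM ha hk) (transposeCLM ha hk')
      (fun φ ↦ ?_) (fun φ ↦ ?_), fun u φ ↦ rfl, fun f hf ↦
      ⟨hk.locallyIntegrableOn_volterra ha hf, ?_⟩, fun u _ ↦ ?_⟩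
  · obtain ⟨r, hr, h0⟩ := φ.exists_support_radius ha
    obtain ⟨p, hp, hpq⟩ := hext r hr
    obtain ⟨K, hK, hKe⟩ := hHk r hr p hp hpq
    obtain ⟨L, hL, hLe⟩ := hHk' r hr p hp hpq
    refine DFunLike.coe_injective ?_
    rw [transposeCLM_apply, transposeCLM_apply,
      volterraTranspose_comp_of_eq hr hk' φ.contDiff h0 hKe hLe]
    exact volterraTranspose_comp hr.le hp hK hL φ.contDiff h0
  · obtain ⟨r, hr, h0⟩ := φ.exists_support_radius ha
    obtain ⟨p, hp, hpq⟩ := hext r hr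
    obtain ⟨K, hK, hKe⟩ := hHk r hr p hp hpq
    obtain ⟨L, hL, hLe⟩ := hHk' r hr p hp hpq
    refine DFunLike.coe_injective ?_
    rw [transposeCLM_apply, transposeCLM_apply,
      volterraTranspose_comp_of_eq hr hk φ.contDiff h0 hLe hKe]
    exact volterraTranspose_comp' hr.le hp hK hL φ.contDiff h0
  · exact ContinuousLinearMap.ext fun φ ↦ regularDistr_transposeCLM ha hk hf φ
  · refine ContinuousLinearMap.ext fun φ ↦ ?_
    obtain ⟨r, hr, h0⟩ := φ.exists_support_radius ha
    obtain ⟨p, hp, hpq⟩ := hext r hr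
    obtain ⟨K, hK, hKe⟩ := hHk r hr p hp hpq
    let D : TestFun a →L[ℂ] TestFun a := TestFunction.lineDerivCLM ℂ (1 : ℝ)
    -- The transposed intertwining relation, proved with `p` and `K` in place of `q` and the kernel
    -- of `H`. Applying `u` to both sides is the claim.
    have key : transposeCLM ha hk (D (D φ) - mulTestFun hq φ) = D (D (transposeCLM ha hk φ)) := by
      refine DFunLike.coe_injective ?_
      have e : ⇑(D (D φ) - mulTestFun hq φ) = fun x ↦ deriv (deriv φ) x - p x * φ x := by
        ext x
        change D (D φ) x - q x * φ x = _
        rw [coe_lineDerivCLM_one, coe_lineDerivCLM_one]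
        by_cases hx : x ∈ Icc (-r) r
        · rw [hpq x hx]
        · rw [h0 x hx, mul_zero, mul_zero]
      have z : ∀ x ∉ Icc (-r) r, deriv (deriv φ) x - p x * φ x = 0 := fun x hx ↦ by
        rw [deriv_eq_zero_of_notMem_Icc (deriv_eq_zero_of_notMem_Icc h0) x hx, h0 x hx, mul_zero,
          sub_zero]
      rw [transposeCLM_apply, e, coe_lineDerivCLM_one, coe_lineDerivCLM_one, transposeCLM_apply,
        show volterraTranspose a (kernel H) φ = volterraTranspose a K φ from
          funext (volterraTranspose_congr hr h0 hKe),
        deriv_deriv_volterraTranspose hr.le hp hK φ.contDiff h0]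
      exact funext (volterraTranspose_congr hr z hKe)
    change distrDeriv a (distrDeriv a _) φ - u (transposeCLM ha hk (mulTestFun hq φ)) =
      distrDeriv a (distrDeriv a u) (transposeCLM ha hk φ)
    rw [distrDeriv_distrDeriv_apply, distrDeriv_distrDeriv_apply]
    change u (transposeCLM ha hk (D (D φ))) - u (transposeCLM ha hk (mulTestFun hq φ)) =
      u (D (D (transposeCLM ha hk φ)))
    rw [← key, map_sub, map_sub]
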